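/- **Setting.** Fix $K\ge 2$. A pair $(X,Y)$ with $X\in\mathbb R^p$, $Y\in\{1,\dots,K\}$ has $\Pr(Y=k)=\pi_k$ and $X\mid Y=k\sim N(\mu_k,\Sigma)$ with $\Sigma=(\sigma_{ij})$ positive definite. Let $\theta_k=\Sigma^{-1}(\mu_k-\mu_1)$ (so $\theta_1=0$), $\theta_{\cdot j}=(\theta_{2j},\dots,\theta_{Kj})$, $\mathcal D=\{j:\theta_{\cdot j}\neq 0\}$, $d=|\mathcal D|$. For a matrix $A$ put $\|A\|_\infty=\max_i\sum_j|a_{ij}|$, and let $\varphi=\max\{\|\Sigma_{\mathcal D^c,\mathcal D}\|_\infty,\|\Sigma_{\mathcal D,\mathcal D}^{-1}\|_\infty\}$, $\Delta=\max\{\max_k\|\mu_k\|_1,\max_k\|\theta_k\|_1\}$, $\eta^*=\|\Sigma_{\mathcal D^c,\mathcal D}\Sigma_{\mathcal D,\mathcal D}^{-1}\|_\infty$, $\theta_{\min}=\min_{\theta_{kj}\ne0}|\theta_{kj}|$, $\theta_{\max}=\max_{k,j}|\theta_{kj}|$, $t_{kj}=\theta_{kj}/\|\theta_{\cdot j}\|_2$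 for $j\in\mathcal D$, and $\kappa=\max_{j\in\mathcal D^c}\{\sum_{k=2}^K(\Sigma_{j,\mathcal D}\Sigma_{\mathcal D,\mathcal D}^{-1}t_{k,\mathcal D})^2\}^{1/2}$. From $n$ i.i.d. copies $(X^i,Y^i)$ of $(X,Y)$ form $n_k=\#\{i:Y^i=k\}$, $\hat\pi_k=n_k/n$, $\hat\mu_k=n_k^{-1}\sum_{Y^i=k}X^i$, $\hat\Sigma=(n-K)^{-1}\sum_k\sum_{Y^i=k}(X^i-\hat\mu_k)(X^i-\hat\mu_k)^T$. For $\lambda>0$ the multiclass sparse discriminant analysis (MSDA) estimate is $$(\hat\theta_2,\dots,\hat\theta_K)\in\arg\min\ \sum_{k=2}^K\Big\{\tfrac12\theta_k^T\hat\Sigma\theta_k-(\hat\mu_k-\hat\mu_1)^T\theta_k\Big\}+\lambda\sum_{j=1}^p\|\theta_{\cdot j}\|_2 ,\qquad \hat\theta_1=0,$$ and the fitted rule assigns $x$ to a class $k$ maximizing $(x-\tfrac{\hat\mu_k+\hat\mu_1}{2})^T\hat\theta_k+\log\hat\pi_k$. Let $R_n$ be the misclassification probability of the fitted rule on an independent copy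 of $(X,Y)$, conditionally on the data, and $R$ the Bayes error (the smallest misclassification probability of a measurable classifier). **Conditions.** (C0) $\kappa<1$. (C1) $c_1/K\le\pi_k\le C_1/K$ for all $k$, and $\theta_{\max}/\theta_{\min}<C_1$, where $c_1>0$. (C2) $n,p\to\infty$ and $d^2\log(pd)/n\to0$. (C3) $\theta_{\min}\gg\{d^2\log(pd)/n\}^{1/2}$. (C4) $\min_{k\ne k'}\{(\theta_k-\theta_{k'})^T\Sigma(\theta_k-\theta_{k'})\}^{1/2}$ is bounded away from $0$. The constants below depend only on $K$, $c_1$, $C_1$ and on fixed upper bounds for $\varphi$, $\Delta$, $\eta^*$, $\max_j\sigma_{jj}$ and for $\kappa$ (the last bound being $<1$); in Part 2 these quantities and bounds are the same along the sequence. **Theorem.** 1. There are constants $M_1,C,c>0$ such that, under (C0)–(C1) with $\mathcal D\neq\emptyset$, if $0<\lambda<\min\{\theta_{\min}/(8\varphi),\,M_1(1-\kappa)\}$ and $0<\epsilon<\min\{1/(2\varphi),\,\lambda/(1+\varphi\Delta)\}$, then with probability greater than $$1-Cpd\exp\Big(-cn\frac{\epsilon^2}{Kd^2}\Big)-CK\exp\Big(-c\frac{n}{K^2}\Big)-Cp(K-1)\exp\Big(-cn\frac{\epsilon^2}{K}\Big)$$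 the MSDA estimate exists and, for every choice of it and of the fitted rule, $|R_n-R|\le M_1\lambda^{1/3}$. 2. For a sequence of such models (with $n$, $p$, the model and $\lambda$ varying, $K$ fixed) satisfying (C0)–(C4), if $\lambda\to0$ and $\{d^2\log(pd)/n\}^{1/2}\ll\lambda$, then $R_n-R\to0$ in probability; more precisely, for every $\delta>0$, with probability tending to $1$ the MSDA estimate exists and, for every choice of it and of the fitted rule, $|R_n-R|\le\delta$. -/

import Mathlib

open MeasureTheory ProbabilityTheory Filter Topology Asymptotics

noncomputable section

/-- A linear discriminant analysis model with `K` classes and `p` predictors: class `k` has prior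
probability `prior k`, and the predictors given class `k` are `N(mean k, cov)`. -/
structure LDAModel (K p : ℕ) where
  prior : Fin K → ℝ
  prior_nonneg : ∀ k, 0 ≤ prior k
  prior_sum : ∑ k, prior k = 1
  mean : Fin K → Fin p → ℝ
  cov : Matrix (Fin p) (Fin p) ℝ
  cov_posDef : cov.PosDef

/-- The norm `‖A‖_∞ = max_i ∑_j |a_ij|` of a matrix (zero for a matrix without rows). -/
def rowSumNorm {ι κ : Type*} [Fintype κ] (A : Matrix ι κ ℝ) : ℝ := ⨆ i, ∑ j, |A i j|

namespace LDAModel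

variable {K p : ℕ}

/-- The joint law of the pair `(X, Y)`: the mixture of the `N(mean k, cov) ⊗ δ_k`. -/
def law (M : LDAModel K p) : Measure (EuclideanSpace ℝ (Fin p) × Fin K) :=
  ∑ k, ENNReal.ofReal (M.prior k) •
    (multivariateGaussian (WithLp.toLp 2 (M.mean k)) M.cov).prod (Measure.dirac k)

/-- The law of a training sample of `n` independent copies of `(X, Y)`. -/
def sampleLaw (M : LDAModel K p) (n : ℕ) :
    Measure (Fin n → EuclideanSpace ℝ (Fin p) × Fin K) :=
  Measure.pi fun _ => M.law

/-- The misclassification probability of a fixed classifier `g` on a new pair `(X, Y)`. -/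
def errorRate (M : LDAModel K p) (g : EuclideanSpace ℝ (Fin p) → Fin K) : ℝ :=
  M.law.real {z | g z.1 ≠ z.2}

/-- The Bayes error: the smallest misclassification probability of a measurable classifier. -/
def bayesError (M : LDAModel K p) : ℝ :=
  ⨅ g : {g : EuclideanSpace ℝ (Fin p) → Fin K // Measurable g}, M.errorRate g.1

variable [NeZero K]

/-- The true discriminant directions `θ_k = Σ⁻¹ (μ_k - μ_1)`. The first class of the text is
`0 : Fin K`, so that `M.theta 0 = 0`. -/
def theta (M : LDAModel K p) (k : Fin K) : Fin p → ℝ :=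
  M.cov⁻¹.mulVec (M.mean k - M.mean 0)

open Classical in
/-- The set `𝒟` of the predictors that enter some discriminant direction. -/
def support (M : LDAModel K p) : Finset (Fin p) :=
  Finset.univ.filter fun j => ∃ k, M.theta k j ≠ 0

/-- The number `d` of elements of `𝒟`. -/
def d (M : LDAModel K p) : ℕ := M.support.card

/-- `Σ_{𝒟,𝒟}`. -/
def covDD (M : LDAModel K p) : Matrix {j // j ∈ M.support} {j // j ∈ M.support} ℝ :=
  M.cov.submatrix Subtype.val Subtype.val

/-- `Σ_{𝒟ᶜ,𝒟}`. -/
def covCD (M : LDAModel K p) : Matrix {j // j ∉ M.support} {j // j ∈ M.support} ℝ :=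
  M.cov.submatrix Subtype.val Subtype.val

/-- `φ = max {‖Σ_{𝒟ᶜ,𝒟}‖_∞, ‖Σ_{𝒟,𝒟}⁻¹‖_∞}`. -/
def phi (M : LDAModel K p) : ℝ := max (rowSumNorm M.covCD) (rowSumNorm M.covDD⁻¹)

/-- `η* = ‖Σ_{𝒟ᶜ,𝒟} Σ_{𝒟,𝒟}⁻¹‖_∞`. -/
def etaStar (M : LDAModel K p) : ℝ := rowSumNorm (M.covCD * M.covDD⁻¹)

/-- `Δ = max {‖μ‖_1, ‖θ‖_1}`, where the `1`-norm of a matrix with columns indexed by the classes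
is the largest `ℓ¹` norm of a column. -/
def Delta (M : LDAModel K p) : ℝ :=
  max (⨆ k, ∑ j, |M.mean k j|) (⨆ k, ∑ j, |M.theta k j|)

/-- `θ_min`, the smallest absolute value of a nonzero coefficient. -/
def thetaMin (M : LDAModel K p) : ℝ :=
  ⨅ a : {a : Fin K × Fin p // M.theta a.1 a.2 ≠ 0}, |M.theta a.1.1 a.1.2|

/-- `θ_max`, the largest absolute value of a coefficient. -/
def thetaMax (M : LDAModel K p) : ℝ := ⨆ a : Fin K × Fin p, |M.theta a.1 a.2|

/-- The gradient `t_{kj} = θ_{kj} / ‖θ_{·j}‖`, `j ∈ 𝒟`, of the group lasso penalty at the true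
coefficients (the terms of the first class vanish). -/
def tGrad (M : LDAModel K p) (k : Fin K) (j : {j // j ∈ M.support}) : ℝ :=
  M.theta k j / √(∑ l, M.theta l j ^ 2)

/-- `κ = max_{j ∈ 𝒟ᶜ} {∑_k (Σ_{j,𝒟} Σ_{𝒟,𝒟}⁻¹ t_{k,𝒟})²}^{1/2}` (zero if `𝒟ᶜ` is empty). -/
def kappa (M : LDAModel K p) : ℝ :=
  ⨆ j, √(∑ k, ((M.covCD * M.covDD⁻¹).mulVec (M.tGrad k) j) ^ 2)

/-- The distance `{(θ_k - θ_l)ᵀ Σ (θ_k - θ_l)}^{1/2}` between two classes. -/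
def classDist (M : LDAModel K p) (k l : Fin K) : ℝ :=
  √((M.theta k - M.theta l) ⬝ᵥ M.cov.mulVec (M.theta k - M.theta l))

/-- The condition `c₁ / K ≤ π_k ≤ C₁ / K` for all `k`, and `θ_max / θ_min < C₁`. -/
def Balanced (M : LDAModel K p) (c₁ C₁ : ℝ) : Prop :=
  (∀ k, c₁ / K ≤ M.prior k ∧ M.prior k ≤ C₁ / K) ∧ M.thetaMax / M.thetaMin < C₁

end LDAModel

namespace MSDA

variable {K p n : ℕ}

/-- The observations of class `k` in the sample. -/
def classIdx (z : Fin n → EuclideanSpace ℝ (Fin p) × Fin K) (k : Fin K) : Finset (Fin n) :=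
  Finset.univ.filter fun i => (z i).2 = k

/-- The sample proportion `n_k / n` of class `k`. -/
def hatPi (z : Fin n → EuclideanSpace ℝ (Fin p) × Fin K) (k : Fin K) : ℝ :=
  (classIdx z k).card / n

/-- The sample mean of class `k`. -/
def hatMu (z : Fin n → EuclideanSpace ℝ (Fin p) × Fin K) (k : Fin K) (j : Fin p) : ℝ :=
  (∑ i ∈ classIdx z k, (z i).1 j) / (classIdx z k).card

/-- The pooled sample covariance matrix. -/
def hatSigma (z : Fin n → EuclideanSpace ℝ (Fin p) × Fin K) : Matrix (Fin p) (Fin p) ℝ :=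
  Matrix.of fun l m => (∑ k, ∑ i ∈ classIdx z k,
    ((z i).1 l - hatMu z k l) * ((z i).1 m - hatMu z k m)) / ((n : ℝ) - K)

variable [NeZero K]

/-- The penalized objective function. On arguments with `th 0 = 0` the terms of the first class
vanish, so that the sums over classes run over the classes other than the first one. -/
def objective (z : Fin n → EuclideanSpace ℝ (Fin p) × Fin K) (lam : ℝ)
    (th : Fin K → Fin p → ℝ) : ℝ :=
  ∑ k, (1 / 2 * (th k ⬝ᵥ (hatSigma z).mulVec (th k)) - (hatMu z k - hatMu z 0) ⬝ᵥ th k)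
    + lam * ∑ j, √(∑ k, th k j ^ 2)

/-- `th` is a solution of the multiclass sparse discriminant analysis problem; the direction of
the first class is zero by convention. -/
def IsEstimate (z : Fin n → EuclideanSpace ℝ (Fin p) × Fin K) (lam : ℝ)
    (th : Fin K → Fin p → ℝ) : Prop :=
  th 0 = 0 ∧ ∀ th' : Fin K → Fin p → ℝ, th' 0 = 0 → objective z lam th ≤ objective z lam th'

/-- The estimated discriminant score of class `k` at `x`. -/
def score (z : Fin n → EuclideanSpace ℝ (Fin p) × Fin K) (th : Fin K → Fin p → ℝ)
    (x : EuclideanSpace ℝ (Fin p)) (k : Fin K) : ℝ :=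
  ∑ j, (x j - (hatMu z k j + hatMu z 0 j) / 2) * th k j + Real.log (hatPi z k)

/-- `g` is a fitted classifier: it assigns every `x` to a class of largest score (ties may be
broken in any measurable way). -/
def IsFittedRule (z : Fin n → EuclideanSpace ℝ (Fin p) × Fin K) (th : Fin K → Fin p → ℝ)
    (g : EuclideanSpace ℝ (Fin p) → Fin K) : Prop :=
  Measurable g ∧ ∀ x k, score z th x k ≤ score z th x (g x)

/-- For the data `z`, the method has a solution, and whatever solution and fitted classifier are
taken, the misclassification probability `R_n` given the data satisfies `|R_n - R| ≤ r`. -/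
def ErrorWithin (M : LDAModel K p) (z : Fin n → EuclideanSpace ℝ (Fin p) × Fin K)
    (lam r : ℝ) : Prop :=
  (∃ th, IsEstimate z lam th) ∧
    ∀ th, IsEstimate z lam th → ∀ g, IsFittedRule z th g →
      |M.errorRate g - M.bayesError| ≤ r

/-- The rate `{d² log (p d) / n}^{1/2}`. -/
def rate (M : LDAModel K p) (n : ℕ) : ℝ :=
  √((M.d : ℝ) ^ 2 * Real.log ((p : ℝ) * M.d) / n)

end MSDA

end

/-!
The finite-sample bound and the consistency both follow from a slow-rate analysis of the penalized
problem, which never asks whether the support `𝒟` is recovered.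

*Deterministic part.* Call a sample good (`MSDA.Close`) if the class means, all entries of the
pooled covariance matrix, and the logarithms of the class proportions are within a small multiple
`τ` of `λ` of their targets. Since the true directions have bounded `ℓ¹` norm, the gradient `Σ̂
θ_k - (μ̂_k - μ̂_1)` of the smooth part at `θ` then has group dual norm at most `λ / 2`.
Completing the square at `θ` shows that the objective is coercive even when `Σ̂` is singular, so
that an estimate exists (`MSDA.exists_isEstimate`), and comparison of the objective at `θ̂` and at
`θ` bounds `‖θ̂_k‖₁` by a constant and `(θ̂_k - θ_k)ᵀ Σ (θ̂_k - θ_k)` by a multiple of `λ`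
(`MSDA.IsEstimate.quadForm_sub_le`).

*Excess risk.* With respect to the law of the first class, the weighted density of class `k` is
the exponential of the population score (`LDAModel.integral_classLaw`, from exponential tilting of
Gaussian vectors). As `exp a - exp b ≤ exp a * (a - b)`, the excess risk of a rule maximizing
estimated scores is at most twice the expected total error of the scores
(`LDAModel.errorRate_sub_le`). The score errors are affine in the predictors, with standard
deviation and mean of the order `√λ`; for `λ ≤ 1` this is at most `λ^{1/3}`, and for `λ > 1` the
error bound is trivial.

*Probability.* The class frequencies, the class-wise centred coordinates and the squares of
centred linear functionals are averages of i.i.d. sub-exponential variables under the mixture law,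
so Chernoff bounds and a union bound make a sample good at level `ε ≤ λ` except with probability
`C p² exp(-c n ε²)` (`MSDA.exists_measure_not_errorWithin_le`). A probability is at most its own
square root, which turns `p²` into `p` at the price of halving `c`: this gives the finite-sample
bound. For consistency one takes `ε = λ`; then `log p = o(n λ²)`, and the bound tends to `0`.
-/

noncomputable section

/-! ### Gaussian vectors: linear functionals, tilting, exponential moments of squares -/

section Gaussian

open Matrix

variable {ι : Type*} [Fintype ι] [DecidableEq ι]

/-- A linear functional of a Gaussian vector, written in coordinates, is a Gaussian variable. -/
theorem map_sum_mul_multivariateGaussian {S : Matrix ι ι ℝ} (hS : S.PosSemidef) (m u : ι → ℝ) :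
    (multivariateGaussian (WithLp.toLp 2 m) S).map (fun x => ∑ j, x j * u j) =
      gaussianReal (∑ j, m j * u j) (u ⬝ᵥ S *ᵥ u).toNNReal := by
  set U : EuclideanSpace ℝ ι := WithLp.toLp 2 u
  have hL : (fun x : EuclideanSpace ℝ ι => ∑ j, x j * u j) = innerSL ℝ U := by
    ext x; simp [PiLp.inner_apply, U]
  have hV : Var[innerSL ℝ U; multivariateGaussian (WithLp.toLp 2 m) S] = u ⬝ᵥ S *ᵥ u := by
    have := covarianceBilin_self (μ := multivariateGaussian (WithLp.toLp 2 m) S)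
      IsGaussian.memLp_two_id U
    rw [covarianceBilin_multivariateGaussian hS] at this
    exact this.symm
  rw [hL, IsGaussian.map_eq_gaussianReal, hV]
  congr 1
  rw [(innerSL ℝ U).integral_comp_id_comm IsGaussian.integrable_id,
    integral_id_multivariateGaussian,
    ← hL]

theorem map_sum_sub_mul_multivariateGaussian {S : Matrix ι ι ℝ} (hS : S.PosSemidef) (m u : ι → ℝ) :
    (multivariateGaussian (WithLp.toLp 2 m) S).map (fun x => ∑ j, (x j - m j) * u j) =
      gaussianReal 0 (u ⬝ᵥ S *ᵥ u).toNNReal := by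
  have h : (fun x : EuclideanSpace ℝ ι => ∑ j, (x j - m j) * u j) =
      (fun y => y - ∑ j, m j * u j) ∘ fun x => ∑ j, x j * u j := by
    ext x; simp [sub_mul, Finset.sum_sub_distrib]
  rw [h, ← Measure.map_map (by fun_prop) (by fun_prop), map_sum_mul_multivariateGaussian hS,
    gaussianReal_map_sub_const, sub_self]

theorem integrable_exp_sum_mul_multivariateGaussian {S : Matrix ι ι ℝ} (hS : S.PosSemidef)
    (m u : ι → ℝ) : Integrable (fun x : EuclideanSpace ℝ ι => Real.exp (∑ j, x j * u j))
      (multivariateGaussian (WithLp.toLp 2 m) S) := by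
  have h := integrable_exp_mul_gaussianReal (μ := ∑ j, m j * u j)
    (v := (u ⬝ᵥ S *ᵥ u).toNNReal) 1
  rw [← map_sum_mul_multivariateGaussian hS, integrable_map_measure (by fun_prop) (by fun_prop)] at h
  simpa [Function.comp_def] using h

theorem integral_exp_sum_mul_multivariateGaussian {S : Matrix ι ι ℝ} (hS : S.PosSemidef)
    (m u : ι → ℝ) : ∫ x, Real.exp (∑ j, x j * u j) ∂(multivariateGaussian (WithLp.toLp 2 m) S) =
      Real.exp (∑ j, m j * u j + u ⬝ᵥ S *ᵥ u / 2) := by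
  have h := mgf_gaussianReal (map_sum_mul_multivariateGaussian hS m u) 1
  have h0 : 0 ≤ u ⬝ᵥ S *ᵥ u := by simpa using hS.dotProduct_mulVec_nonneg u
  simpa [mgf, Real.coe_toNNReal _ h0] using h

/-- Exponential tilting of a Gaussian vector by a linear functional shifts its mean. Both sides
have the same moment generating function along every direction. -/
theorem tilted_multivariateGaussian {S : Matrix ι ι ℝ} (hS : S.PosSemidef) (m u : ι → ℝ) :
    (multivariateGaussian (WithLp.toLp 2 m) S).tilted (fun x => ∑ j, x j * u j) =
      multivariateGaussian (WithLp.toLp 2 (m + S *ᵥ u)) S := by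
  have hint := integrable_exp_sum_mul_multivariateGaussian hS m u
  have : IsProbabilityMeasure
      ((multivariateGaussian (WithLp.toLp 2 m) S).tilted (fun x => ∑ j, x j * u j)) :=
    isProbabilityMeasure_tilted hint
  refine Measure.ext_of_charFunDual (funext fun L => ?_)
  rw [charFunDual_eq_charFun_map_one, charFunDual_eq_charFun_map_one]
  congr 1
  obtain ⟨U, rfl⟩ := (InnerProductSpace.toDual ℝ (EuclideanSpace ℝ ι)).surjective L
  have hL : ((InnerProductSpace.toDual ℝ (EuclideanSpace ℝ ι)) U : EuclideanSpace ℝ ι → ℝ) =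
      fun x : EuclideanSpace ℝ ι => ∑ j, x j * U j := by
    ext x; simp [PiLp.inner_apply]
  rw [hL, map_sum_mul_multivariateGaussian hS]
  have hmgf : ∀ t, mgf (fun x : EuclideanSpace ℝ ι => ∑ j, x j * U j)
      ((multivariateGaussian (WithLp.toLp 2 m) S).tilted (fun x => ∑ j, x j * u j)) t =
      mgf id (gaussianReal (∑ j, (m + S *ᵥ u) j * U j) (U.ofLp ⬝ᵥ S *ᵥ U.ofLp).toNNReal) t := by
    intro t
    have h0 : 0 ≤ U.ofLp ⬝ᵥ S *ᵥ U.ofLp := by simpa using hS.dotProduct_mulVec_nonneg U.ofLp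
    have hsymm : u ⬝ᵥ S *ᵥ U.ofLp = U.ofLp ⬝ᵥ S *ᵥ u := by
      rw [dotProduct_mulVec, ← mulVec_transpose, dotProduct_comm]
      congr 2
      simpa using hS.isHermitian.eq
    have hcomb : ∀ x : EuclideanSpace ℝ ι, (∑ j, x j * u j) + t * ∑ j, x j * U j =
        ∑ j, x j * (u + t • U.ofLp) j := by
      intro x
      rw [Finset.mul_sum, ← Finset.sum_add_distrib]
      exact Finset.sum_congr rfl fun j _ => by simp; ring
    have hcomb' : ∑ j, (m + S *ᵥ u) j * U j = ∑ j, m j * U j + U.ofLp ⬝ᵥ S *ᵥ u := by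
      simp [add_mul, Finset.sum_add_distrib, dotProduct, mul_comm]
    have hm : ∑ j, m j * (u + t • U.ofLp) j = ∑ j, m j * u j + t * ∑ j, m j * U j := by
      rw [Finset.mul_sum, ← Finset.sum_add_distrib]
      exact Finset.sum_congr rfl fun j _ => by simp; ring
    rw [mgf_id_gaussianReal, mgf, integral_exp_tilted]
    simp only [Pi.add_apply]
    simp_rw [hcomb]
    rw [integral_exp_sum_mul_multivariateGaussian hS, integral_exp_sum_mul_multivariateGaussian hS,
      ← Real.exp_sub, Real.coe_toNNReal _ h0]
    congr 1
    rw [show (∑ x, (m x + (S *ᵥ u) x) * U.ofLp x) = ∑ j, (m + S *ᵥ u) j * U j from rfl, hcomb', hm,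
      mulVec_add, mulVec_smul]
    simp only [dotProduct_add, add_dotProduct, smul_dotProduct, dotProduct_smul, smul_eq_mul]
    rw [hsymm]
    ring
  have hset : integrableExpSet (fun x : EuclideanSpace ℝ ι => ∑ j, x j * U j)
      ((multivariateGaussian (WithLp.toLp 2 m) S).tilted (fun x => ∑ j, x j * u j)) = Set.univ := by
    rw [integrableExpSet_eq_of_mgf (funext hmgf), integrableExpSet_id_gaussianReal]
  have h := Measure.ext_of_complexMGF_eq (by fun_prop) (by fun_prop) <| funext fun z =>
    eqOn_complexMGF_of_mgf (funext hmgf) (by simp [hset])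
  rwa [Measure.map_id] at h

theorem integrable_abs_gaussianReal (v : NNReal) :
    Integrable (fun x => |x|) (gaussianReal 0 v) := by
  have : Integrable (fun x : ℝ => x) (gaussianReal 0 v) :=
    (memLp_id_gaussianReal (μ := 0) (v := v) 1).integrable (by simp)
  exact this.abs

theorem integral_abs_gaussianReal_le (v : NNReal) :
    ∫ x, |x| ∂(gaussianReal 0 v) ≤ √(v : ℝ) := by
  rcases eq_or_ne v 0 with rfl | hv
  · simp
  have hv0 : 0 < (v : ℝ) := by positivity
  have hs : 0 < √(v : ℝ) := Real.sqrt_pos.2 hv0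
  have hsq : ∫ x, x ^ 2 ∂(gaussianReal 0 v) = v := by
    have h := variance_id_gaussianReal (μ := 0) (v := v)
    rw [variance_eq_integral aemeasurable_id] at h
    simpa using h
  have hi : Integrable (fun x : ℝ => x ^ 2) (gaussianReal 0 v) :=
    (memLp_id_gaussianReal (μ := 0) (v := v) 2).integrable_sq
  calc ∫ x, |x| ∂(gaussianReal 0 v)
      ≤ ∫ x, (x ^ 2 / √(v : ℝ) + √(v : ℝ)) / 2 ∂(gaussianReal 0 v) := by
        refine integral_mono (integrable_abs_gaussianReal v)
          (((hi.div_const _).add (integrable_const _)).div_const _) fun x => ?_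
        have h1 : 0 ≤ (|x| - √(v : ℝ)) ^ 2 / √(v : ℝ) := by positivity
        have h2 : (|x| - √(v : ℝ)) ^ 2 / √(v : ℝ) = x ^ 2 / √(v : ℝ) + √(v : ℝ) - 2 * |x| := by
          field_simp
          rw [sub_sq, sq_abs]; ring
        linarith
    _ = √(v : ℝ) := by
        rw [integral_div, integral_add (hi.div_const _) (integrable_const _), integral_div, hsq]
        simp only [integral_const, probReal_univ, one_smul, Real.div_sqrt]
        ring

/-- The centred square of a Gaussian variable is sub-exponential. -/
theorem integrable_exp_sq_gaussianReal {v : NNReal} {t : ℝ} (ht : |t| * v ≤ 1 / 4) :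
    Integrable (fun x => Real.exp (t * (x ^ 2 - v))) (gaussianReal 0 v) ∧
      ∫ x, Real.exp (t * (x ^ 2 - v)) ∂(gaussianReal 0 v) ≤ Real.exp (4 * v ^ 2 * t ^ 2) := by
  rcases eq_or_ne v 0 with rfl | hv
  · simp [integrable_dirac]
  have hv0 : 0 < (v : ℝ) := by positivity
  obtain ⟨ht1, ht2⟩ := abs_le.1 (show |t * v| ≤ 1 / 4 by rwa [abs_mul, abs_of_pos hv0])
  set b : ℝ := 1 / (2 * v) - t with hb
  have hb' : b = (1 - 2 * (t * v)) / (2 * v) := by rw [hb]; field_simp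
  have hbpos : 0 < b := by rw [hb']; apply div_pos <;> linarith
  have hfun : ∀ x, gaussianPDFReal 0 v x • Real.exp (t * (x ^ 2 - v)) =
      (√(2 * Real.pi * v))⁻¹ * Real.exp (-(t * v)) * Real.exp (-b * x ^ 2) := by
    intro x
    rw [gaussianPDFReal, smul_eq_mul, mul_assoc (_⁻¹), mul_assoc (_⁻¹), ← Real.exp_add,
      ← Real.exp_add]
    congr 2
    rw [hb]; field_simp; ring
  constructor
  · rw [gaussianReal_of_var_ne_zero _ hv,
      integrable_withDensity_iff_integrable_smul' (measurable_gaussianPDF _ _)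
        (ae_of_all _ fun _ => gaussianPDF_lt_top)]
    simp_rw [toReal_gaussianPDF, hfun]
    exact (integrable_exp_neg_mul_sq hbpos).const_mul _
  · rw [integral_gaussianReal_eq_integral_smul hv]
    simp_rw [hfun]
    rw [integral_const_mul, integral_gaussian]
    have hy : |2 * (t * v)| ≤ 1 / 2 := by rw [abs_le]; constructor <;> linarith
    have hlog := Real.abs_log_sub_add_sum_range_le (x := 2 * (t * v)) (by linarith) 1
    simp only [Finset.range_one, Finset.sum_singleton, zero_add, pow_one, Nat.cast_zero, div_one,
      Nat.reduceAdd] at hlog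
    have hlog' : |2 * (t * v)| ^ 2 / (1 - |2 * (t * v)|) ≤ 2 * (2 * (t * v)) ^ 2 := by
      rw [div_le_iff₀ (by linarith), sq_abs]
      nlinarith [sq_nonneg (2 * (t * v))]
    have hlog2 : -(2 * (t * v)) - 2 * (2 * (t * v)) ^ 2 ≤ Real.log (1 - 2 * (t * v)) := by
      linarith [(abs_le.1 (hlog.trans hlog')).1]
    have hpos : 0 < 1 - 2 * (t * v) := by linarith
    have hsq : √(Real.pi / b) = √(2 * Real.pi * v) * (√(1 - 2 * (t * v)))⁻¹ := by
      rw [← Real.sqrt_inv, ← Real.sqrt_mul (by positivity)]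
      congr 1
      rw [hb']; field_simp
    have hexp : (√(1 - 2 * (t * v)))⁻¹ = Real.exp (-(Real.log (1 - 2 * (t * v)) / 2)) := by
      rw [Real.exp_neg, ← Real.log_sqrt hpos.le, Real.exp_log (Real.sqrt_pos.2 hpos)]
    rw [hsq, hexp]
    have hne : √(2 * Real.pi * v) ≠ 0 := by positivity
    rw [show ∀ a c d : ℝ, a⁻¹ * c * (a * d) = a⁻¹ * a * (c * d) from fun _ _ _ => by ring,
      inv_mul_cancel₀ hne, one_mul, ← Real.exp_add]
    apply Real.exp_le_exp.2
    nlinarith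

end Gaussian

/-! ### Chernoff bounds for sub-exponential averages under the mixture law -/

section Chernoff

variable {Ω : Type*} [MeasurableSpace Ω]

/-- `f` has a sub-exponential law under `μ`: its exponential moments of order `t`, `|t| ≤ b`, exist
and satisfy the sub-Gaussian bound `exp (V t²)`. -/
def HasExpBound (f : Ω → ℝ) (μ : Measure Ω) (V b : ℝ) : Prop :=
  ∀ t, |t| ≤ b → Integrable (fun x => Real.exp (t * f x)) μ ∧
    ∫ x, Real.exp (t * f x) ∂μ ≤ Real.exp (V * t ^ 2)

variable {f : Ω → ℝ} {μ : Measure Ω} {V b : ℝ}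

theorem HasExpBound.mono (h : HasExpBound f μ V b) {V' b' : ℝ} (hV : V ≤ V') (hb : b' ≤ b) :
    HasExpBound f μ V' b' := fun t ht =>
  ⟨(h t (ht.trans hb)).1, (h t (ht.trans hb)).2.trans (Real.exp_le_exp.2 (by gcongr))⟩

theorem HasExpBound.neg (h : HasExpBound f μ V b) : HasExpBound (fun x => -f x) μ V b :=
  fun t ht => by
    simpa [neg_mul, mul_neg] using h (-t) (by simpa using ht)

theorem HasExpBound.pi_sum_ge_le [IsProbabilityMeasure μ] (h : HasExpBound f μ V b) (hV : 0 < V)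
    (n : ℕ) {s : ℝ} (hs : 0 ≤ s) (hsb : s ≤ 2 * V * b) :
    (Measure.pi fun _ : Fin n => μ).real {z | n * s ≤ ∑ i, f (z i)} ≤
      Real.exp (-(n * s ^ 2 / (4 * V))) := by
  -- the exponent `t` minimizes `V t² - t s`
  set t := s / (2 * V) with ht
  have ht0 : 0 ≤ t := by positivity
  obtain ⟨h1, h2⟩ := h t (by rw [abs_of_nonneg ht0, ht, div_le_iff₀ (by positivity)]; linarith)
  have hexp : ∀ z : Fin n → Ω, Real.exp (t * ∑ i, f (z i)) = ∏ i, Real.exp (t * f (z i)) := by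
    intro z; rw [Finset.mul_sum, Real.exp_sum]
  refine (measure_ge_le_exp_mul_mgf (n * s) ht0 ?_).trans ?_
  · simp_rw [hexp]
    exact Integrable.fintype_prod (f := fun _ x => Real.exp (t * f x)) fun _ => h1
  · rw [mgf]
    simp_rw [hexp]
    rw [integral_fintype_prod_eq_prod (fun _ x => Real.exp (t * f x)), Finset.prod_const,
      Finset.card_univ, Fintype.card_fin]
    calc Real.exp (-t * (n * s)) * (∫ x, Real.exp (t * f x) ∂μ) ^ n
        ≤ Real.exp (-t * (n * s)) * Real.exp (V * t ^ 2) ^ n := by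
          gcongr
      _ = Real.exp (-(n * s ^ 2 / (4 * V))) := by
          rw [← Real.exp_nat_mul, ← Real.exp_add, ht]
          congr 1
          field_simp
          ring

theorem HasExpBound.pi_abs_sum_ge_le [IsProbabilityMeasure μ] (h : HasExpBound f μ V b)
    (hV : 0 < V) (n : ℕ) {s : ℝ} (hs : 0 ≤ s) (hsb : s ≤ 2 * V * b) :
    (Measure.pi fun _ : Fin n => μ).real {z | n * s ≤ |∑ i, f (z i)|} ≤
      2 * Real.exp (-(n * s ^ 2 / (4 * V))) := by
  have hsub : {z : Fin n → Ω | n * s ≤ |∑ i, f (z i)|} ⊆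
      {z | n * s ≤ ∑ i, f (z i)} ∪ {z | n * s ≤ ∑ i, -f (z i)} := by
    intro z hz
    simpa only [Set.mem_union, Set.mem_ofPred_eq, Finset.sum_neg_distrib] using le_abs.1 hz
  refine (measureReal_mono hsub).trans ((measureReal_union_le _ _).trans ?_)
  linarith [h.pi_sum_ge_le hV n hs hsb, h.neg.pi_sum_ge_le hV n hs hsb]

end Chernoff

namespace LDAModel

open Matrix

variable {K p : ℕ}

/-- The law of the predictors given class `k`. -/
def classLaw (M : LDAModel K p) (k : Fin K) : Measure (EuclideanSpace ℝ (Fin p)) :=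
  multivariateGaussian (WithLp.toLp 2 (M.mean k)) M.cov

instance (M : LDAModel K p) (k : Fin K) : IsProbabilityMeasure (M.classLaw k) := by
  unfold classLaw; infer_instance

theorem law_eq_sum_map (M : LDAModel K p) :
    M.law = ∑ k, ENNReal.ofReal (M.prior k) • (M.classLaw k).map (fun x => (x, k)) := by
  simp only [law, Measure.prod_dirac, classLaw]

theorem law_integral (M : LDAModel K p) {f : EuclideanSpace ℝ (Fin p) × Fin K → ℝ}
    (hf : Measurable f) (hi : ∀ k, Integrable (fun x => f (x, k)) (M.classLaw k)) :
    Integrable f M.law ∧ ∫ z, f z ∂M.law = ∑ k, M.prior k * ∫ x, f (x, k) ∂(M.classLaw k) := by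
  have h : ∀ k, Integrable f ((M.classLaw k).map (fun x => (x, k))) := fun k =>
    (integrable_map_measure hf.aestronglyMeasurable (by fun_prop)).2 (hi k)
  have h' : ∀ k ∈ Finset.univ, Integrable f
      (ENNReal.ofReal (M.prior k) • (M.classLaw k).map (fun x => (x, k))) := fun k _ =>
    (h k).smul_measure ENNReal.ofReal_ne_top
  rw [law_eq_sum_map]
  refine ⟨integrable_finsetSum_measure.2 h', ?_⟩
  rw [integral_finsetSum_measure h']
  refine Finset.sum_congr rfl fun k _ => ?_
  rw [integral_smul_measure, integral_map (by fun_prop) hf.aestronglyMeasurable,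
    ENNReal.toReal_ofReal (M.prior_nonneg k), smul_eq_mul]

instance (M : LDAModel K p) : IsProbabilityMeasure M.law := by
  refine ⟨?_⟩
  rw [law_eq_sum_map, Measure.finsetSum_apply]
  simp only [Measure.smul_apply, smul_eq_mul]
  have : ∀ k : Fin K, ((M.classLaw k).map (fun x => (x, k))) Set.univ = 1 := fun k => by
    rw [Measure.map_apply (by fun_prop) MeasurableSet.univ]; simp
  simp only [this, mul_one]
  rw [← ENNReal.ofReal_sum_of_nonneg fun k _ => M.prior_nonneg k, M.prior_sum, ENNReal.ofReal_one]

instance (M : LDAModel K p) (n : ℕ) : IsProbabilityMeasure (M.sampleLaw n) := by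
  unfold sampleLaw; infer_instance

theorem integral_label_law (M : LDAModel K p) (k : Fin K) :
    ∫ z, (if z.2 = k then (1 : ℝ) else 0) ∂M.law = M.prior k := by
  have hm : Measurable fun z : EuclideanSpace ℝ (Fin p) × Fin K => if z.2 = k then (1 : ℝ) else 0 :=
    measurable_from_prod_countable_left fun y => by by_cases h : y = k <;> simp [h]
  have h : ∀ l, Integrable (fun _ : EuclideanSpace ℝ (Fin p) => if l = k then (1 : ℝ) else 0)
      (M.classLaw l) ∧ ∫ _, (if l = k then (1 : ℝ) else 0) ∂(M.classLaw l) =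
        if l = k then (1 : ℝ) else 0 := fun l => by
    by_cases hl : l = k <;> simp [hl]
  rw [(M.law_integral hm fun l => (h l).1).2]
  simp only [(h _).2, mul_ite, mul_one, mul_zero, Finset.sum_ite_eq', Finset.mem_univ, if_true]

/-- Exponential moment bounds given each class pass to the mixture. -/
theorem hasExpBound_law (M : LDAModel K p) {f : EuclideanSpace ℝ (Fin p) × Fin K → ℝ}
    (hf : Measurable f) {V b : ℝ}
    (h : ∀ k, HasExpBound (fun x => f (x, k)) (M.classLaw k) V b) : HasExpBound f M.law V b := by
  intro t ht
  obtain ⟨h1, h2⟩ := M.law_integral (f := fun z => Real.exp (t * f z)) (by fun_prop)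
    fun k => (h k t ht).1
  refine ⟨h1, h2.le.trans ?_⟩
  calc ∑ k, M.prior k * ∫ x, Real.exp (t * f (x, k)) ∂(M.classLaw k)
      ≤ ∑ k, M.prior k * Real.exp (V * t ^ 2) :=
        Finset.sum_le_sum fun k _ => mul_le_mul_of_nonneg_left (h k t ht).2 (M.prior_nonneg k)
    _ = Real.exp (V * t ^ 2) := by rw [← Finset.sum_mul, M.prior_sum, one_mul]

theorem hasExpBound_label (M : LDAModel K p) (k : Fin K) (b : ℝ) :
    HasExpBound (fun z => (if z.2 = k then (1 : ℝ) else 0) - M.prior k) M.law 1 b := by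
  have hm : Measurable fun z : EuclideanSpace ℝ (Fin p) × Fin K => if z.2 = k then (1 : ℝ) else 0 :=
    measurable_from_prod_countable_left fun y => by by_cases h : y = k <;> simp [h]
  have h := hasSubgaussianMGF_of_mem_Icc (μ := M.law) (a := 0) (b := 1) hm.aemeasurable
    (ae_of_all _ fun z => by by_cases h : z.2 = k <;> simp [h])
  rw [integral_label_law] at h
  refine fun t _ => ⟨h.integrable_exp_mul t, (h.mgf_le t).trans (Real.exp_le_exp.2 ?_)⟩
  simp
  nlinarith [sq_nonneg t]

theorem quadForm_nonneg (M : LDAModel K p) (u : Fin p → ℝ) : 0 ≤ u ⬝ᵥ M.cov *ᵥ u := by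
  simpa using M.cov_posDef.posSemidef.dotProduct_mulVec_nonneg u

theorem map_classLaw (M : LDAModel K p) (k : Fin K) (u : Fin p → ℝ) :
    (M.classLaw k).map (fun x => ∑ j, (x j - M.mean k j) * u j) =
      gaussianReal 0 (u ⬝ᵥ M.cov *ᵥ u).toNNReal :=
  map_sum_sub_mul_multivariateGaussian M.cov_posDef.posSemidef _ _

theorem hasExpBound_coord (M : LDAModel K p) (k : Fin K) (j : Fin p) (b : ℝ) {v : ℝ}
    (hv : M.cov j j ≤ v) :
    HasExpBound (fun z => if z.2 = k then z.1 j - M.mean k j else 0) M.law v b := by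
  have hv0 : 0 ≤ M.cov j j := M.cov_posDef.posSemidef.diag_nonneg
  refine M.hasExpBound_law (measurable_from_prod_countable_left fun y => ?_) fun l t _ => ?_
  · by_cases h : y = k <;> simp only [h, if_true, if_false] <;> fun_prop
  by_cases h : l = k
  · subst h
    have hmap := M.map_classLaw l (Pi.single j 1)
    simp only [Pi.single_apply, mul_ite, mul_one, mul_zero, Finset.sum_ite_eq', Finset.mem_univ,
      if_true] at hmap
    have hq : (Pi.single j 1 : Fin p → ℝ) ⬝ᵥ M.cov *ᵥ Pi.single j 1 = M.cov j j := by simp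
    rw [hq] at hmap
    simp only [if_true]
    constructor
    · have := integrable_exp_mul_gaussianReal (μ := 0) (v := (M.cov j j).toNNReal) t
      rw [← hmap, integrable_map_measure (by fun_prop) (by fun_prop)] at this
      exact this
    · have := mgf_gaussianReal hmap t
      rw [mgf] at this
      rw [this, Real.coe_toNNReal _ hv0]
      apply Real.exp_le_exp.2
      nlinarith [sq_nonneg t]
  · simp only [h, if_false, mul_zero, Real.exp_zero, integrable_const, integral_const,
      probReal_univ, one_smul, true_and]
    exact Real.one_le_exp (by have := hv0.trans hv; positivity)

theorem hasExpBound_sq (M : LDAModel K p) (u : Fin p → ℝ) {w : ℝ} (hw : u ⬝ᵥ M.cov *ᵥ u ≤ w)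
    (hw0 : 0 < w) :
    HasExpBound (fun z => (∑ j, (z.1 j - M.mean z.2 j) * u j) ^ 2 - u ⬝ᵥ M.cov *ᵥ u) M.law
      (4 * w ^ 2) (1 / (4 * w)) := by
  have hq := M.quadForm_nonneg u
  refine M.hasExpBound_law (measurable_from_prod_countable_left fun y => by fun_prop)
    fun k t ht => ?_
  have ht' : |t| * (u ⬝ᵥ M.cov *ᵥ u) ≤ 1 / 4 :=
    calc |t| * (u ⬝ᵥ M.cov *ᵥ u) ≤ 1 / (4 * w) * w := by gcongr
      _ = 1 / 4 := by field_simp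
  have h := integrable_exp_sq_gaussianReal (v := (u ⬝ᵥ M.cov *ᵥ u).toNNReal) (t := t)
    (by rwa [Real.coe_toNNReal _ hq])
  rw [Real.coe_toNNReal _ hq, ← M.map_classLaw k,
    integrable_map_measure (by fun_prop) (by fun_prop), integral_map (by fun_prop) (by fun_prop)] at h
  refine ⟨h.1, h.2.trans (Real.exp_le_exp.2 ?_)⟩
  gcongr

/-- Polarization: the variance of `X_l + r X_m`, `r = ± 1`. -/
theorem quadForm_single_add (M : LDAModel K p) (l m : Fin p) (r : ℝ) :
    (Pi.single l 1 + r • Pi.single m 1 : Fin p → ℝ) ⬝ᵥ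
        M.cov *ᵥ (Pi.single l 1 + r • Pi.single m 1) =
        M.cov l l + 2 * r * M.cov l m + r ^ 2 * M.cov m m := by
  have hsym : M.cov m l = M.cov l m := by simpa using M.cov_posDef.isHermitian.apply l m
  simp [mulVec_add, mulVec_smul, add_dotProduct, smul_dotProduct, hsym]
  ring

theorem abs_cov_le (M : LDAModel K p) {v : ℝ} (hv : ∀ j, M.cov j j ≤ v) (l m : Fin p) :
    |M.cov l m| ≤ v := by
  have key : ∀ r : ℝ, 0 ≤ M.cov l l + 2 * r * M.cov l m + r ^ 2 * M.cov m m := fun r => by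
    rw [← quadForm_single_add]
    exact M.quadForm_nonneg _
  have h1 := key 1
  have h2 := key (-1)
  have := hv l
  have := hv m
  rw [abs_le]; constructor <;> linarith

end LDAModel

/-! ### The estimate on a good sample: existence and slow rate -/

namespace LDAModel

variable {K p : ℕ} [NeZero K]

theorem sum_abs_mean_le_Delta (M : LDAModel K p) (k : Fin K) : ∑ j, |M.mean k j| ≤ M.Delta :=
  (le_ciSup (f := fun k => ∑ j, |M.mean k j|) (Set.finite_range _).bddAbove k).trans
    (le_max_left _ _)

theorem sum_abs_theta_le_Delta (M : LDAModel K p) (k : Fin K) : ∑ j, |M.theta k j| ≤ M.Delta :=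
  (le_ciSup (f := fun k => ∑ j, |M.theta k j|) (Set.finite_range _).bddAbove k).trans
    (le_max_right _ _)

theorem Delta_nonneg (M : LDAModel K p) : 0 ≤ M.Delta :=
  (Finset.sum_nonneg fun _ _ => abs_nonneg _).trans (M.sum_abs_mean_le_Delta 0)

theorem theta_zero (M : LDAModel K p) : M.theta 0 = 0 := by simp [theta]

theorem cov_mulVec_theta (M : LDAModel K p) (k : Fin K) :
    M.cov.mulVec (M.theta k) = M.mean k - M.mean 0 := by
  rw [theta, Matrix.mulVec_mulVec,
    Matrix.mul_nonsing_inv _ ((Matrix.isUnit_iff_isUnit_det _).1 M.cov_posDef.isUnit),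
    Matrix.one_mulVec]

end LDAModel

theorem abs_dotProduct_le_mul_sum_abs {ι : Type*} [Fintype ι] {a b : ι → ℝ} {t : ℝ}
    (ha : ∀ i, |a i| ≤ t) : |a ⬝ᵥ b| ≤ t * ∑ i, |b i| := by
  rw [dotProduct, Finset.mul_sum]
  refine (Finset.abs_sum_le_sum_abs _ _).trans (Finset.sum_le_sum fun i _ => ?_)
  rw [abs_mul]
  exact mul_le_mul_of_nonneg_right (ha i) (abs_nonneg _)

theorem quadForm_complete_square {ι : Type*} [Fintype ι] {S : Matrix ι ι ℝ} (hS : S.IsSymm)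
    (t θ δ : ι → ℝ) :
    1 / 2 * (t ⬝ᵥ S.mulVec t) - δ ⬝ᵥ t =
      1 / 2 * ((t - θ) ⬝ᵥ S.mulVec (t - θ)) - 1 / 2 * (θ ⬝ᵥ S.mulVec θ)
        + (S.mulVec θ - δ) ⬝ᵥ t := by
  have h : θ ⬝ᵥ S.mulVec t = t ⬝ᵥ S.mulVec θ := by
    rw [Matrix.dotProduct_mulVec, ← Matrix.mulVec_transpose, hS.eq, dotProduct_comm]
  rw [Matrix.mulVec_sub, sub_dotProduct, dotProduct_sub, dotProduct_sub, sub_dotProduct, h,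
    dotProduct_comm (S.mulVec θ) t]
  ring

namespace MSDA

variable {K p n : ℕ}

/-- The group lasso penalty `∑_j ‖θ_{·j}‖₂`. -/
def groupNorm (th : Fin K → Fin p → ℝ) : ℝ := ∑ j, √(∑ k, th k j ^ 2)

theorem groupNorm_nonneg (th : Fin K → Fin p → ℝ) : 0 ≤ groupNorm th :=
  Finset.sum_nonneg fun _ _ => Real.sqrt_nonneg _

theorem abs_le_sqrt_sum_sq (f : Fin K → ℝ) (k : Fin K) : |f k| ≤ √(∑ l, f l ^ 2) :=
  Real.abs_le_sqrt (Finset.single_le_sum (f := fun l => f l ^ 2) (fun _ _ => sq_nonneg _)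
    (Finset.mem_univ k))

theorem sqrt_sum_sq_le (f : Fin K → ℝ) : √(∑ l, f l ^ 2) ≤ ∑ l, |f l| := by
  apply Real.sqrt_le_iff.2 ⟨Finset.sum_nonneg fun _ _ => abs_nonneg _, ?_⟩
  simpa only [sq_abs] using
    Finset.sum_sq_le_sq_sum_of_nonneg (s := Finset.univ) (f := fun l => |f l|)
      fun _ _ => abs_nonneg _

theorem sum_abs_le_groupNorm (th : Fin K → Fin p → ℝ) (k : Fin K) :
    ∑ j, |th k j| ≤ groupNorm th :=
  Finset.sum_le_sum fun j _ => abs_le_sqrt_sum_sq (fun l => th l j) k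

theorem groupNorm_le (th : Fin K → Fin p → ℝ) : groupNorm th ≤ ∑ k, ∑ j, |th k j| := by
  rw [Finset.sum_comm]
  exact Finset.sum_le_sum fun j _ => sqrt_sum_sq_le fun l => th l j

/-- Duality of the group norm with the norm `max_j ‖g_{·j}‖₂`. -/
theorem abs_sum_dotProduct_le_groupNorm {g : Fin K → Fin p → ℝ} {G : ℝ}
    (hg : ∀ j, √(∑ k, g k j ^ 2) ≤ G) (th : Fin K → Fin p → ℝ) :
    |∑ k, g k ⬝ᵥ th k| ≤ G * groupNorm th := by
  simp only [dotProduct]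
  rw [Finset.sum_comm, groupNorm, Finset.mul_sum]
  refine (Finset.abs_sum_le_sum_abs _ _).trans (Finset.sum_le_sum fun j _ => ?_)
  calc |∑ k, g k j * th k j| ≤ √(∑ k, g k j ^ 2) * √(∑ k, th k j ^ 2) := by
        rw [← Real.sqrt_mul (Finset.sum_nonneg fun _ _ => sq_nonneg _)]
        exact Real.abs_le_sqrt (Finset.sum_mul_sq_le_sq_mul_sq _ _ _)
    _ ≤ G * √(∑ k, th k j ^ 2) := mul_le_mul_of_nonneg_right (hg j) (Real.sqrt_nonneg _)

/-- On the sample `z` all the empirical quantities are within `τ` of their targets, and the pooled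
covariance matrix is positive semidefinite. -/
structure Close (M : LDAModel K p) (z : Fin n → EuclideanSpace ℝ (Fin p) × Fin K) (τ : ℝ) :
    Prop where
  abs_hatMu_sub_le : ∀ k j, |hatMu z k j - M.mean k j| ≤ τ
  abs_hatSigma_sub_le : ∀ l m, |hatSigma z l m - M.cov l m| ≤ τ
  abs_log_hatPi_sub_le : ∀ k, |Real.log (hatPi z k) - Real.log (M.prior k)| ≤ τ
  quadForm_nonneg : ∀ u : Fin p → ℝ, 0 ≤ u ⬝ᵥ (hatSigma z).mulVec u

theorem hatSigma_isSymm (z : Fin n → EuclideanSpace ℝ (Fin p) × Fin K) : (hatSigma z).IsSymm := by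
  ext l m
  simp [hatSigma, mul_comm]

theorem abs_quadForm_sub_le {M : LDAModel K p} {z : Fin n → EuclideanSpace ℝ (Fin p) × Fin K}
    {τ : ℝ} (hz : Close M z τ) (h : Fin p → ℝ) :
    |h ⬝ᵥ (hatSigma z).mulVec h - h ⬝ᵥ M.cov.mulVec h| ≤ τ * (∑ j, |h j|) ^ 2 := by
  rw [← dotProduct_sub, ← Matrix.sub_mulVec, dotProduct_comm]
  refine (abs_dotProduct_le_mul_sum_abs (t := τ * ∑ j, |h j|) fun l => ?_).trans
    (le_of_eq (by ring))
  exact abs_dotProduct_le_mul_sum_abs fun m => hz.abs_hatSigma_sub_le l m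

variable [NeZero K]

/-- The gradient of the smooth part of the objective at the true directions. -/
def residual (M : LDAModel K p) (z : Fin n → EuclideanSpace ℝ (Fin p) × Fin K) (k : Fin K) :
    Fin p → ℝ :=
  (hatSigma z).mulVec (M.theta k) - (hatMu z k - hatMu z 0)

theorem objective_eq (M : LDAModel K p) (z : Fin n → EuclideanSpace ℝ (Fin p) × Fin K) (lam : ℝ)
    (th : Fin K → Fin p → ℝ) :
    objective z lam th =
      1 / 2 * ∑ k, (th k - M.theta k) ⬝ᵥ (hatSigma z).mulVec (th k - M.theta k)
        - 1 / 2 * ∑ k, M.theta k ⬝ᵥ (hatSigma z).mulVec (M.theta k)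
        + ∑ k, residual M z k ⬝ᵥ th k + lam * groupNorm th := by
  simp only [objective, groupNorm, residual]
  rw [Finset.sum_congr rfl fun k _ =>
    quadForm_complete_square (hatSigma_isSymm z) (th k) (M.theta k) (hatMu z k - hatMu z 0),
    Finset.sum_add_distrib, Finset.sum_sub_distrib, ← Finset.mul_sum, ← Finset.mul_sum]

variable {M : LDAModel K p} {z : Fin n → EuclideanSpace ℝ (Fin p) × Fin K} {τ D lam : ℝ}

theorem sqrt_sum_residual_sq_le (hz : Close M z τ) (hD : M.Delta ≤ D)
    (hlam : K * (D + 2) * τ ≤ lam / 2) (j : Fin p) :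
    √(∑ k, residual M z k j ^ 2) ≤ lam / 2 := by
  have hτ : 0 ≤ τ := (abs_nonneg _).trans (hz.abs_log_hatPi_sub_le 0)
  have h : ∀ k, |residual M z k j| ≤ (D + 2) * τ := fun k => by
    have h1 : |(hatSigma z - M.cov).mulVec (M.theta k) j| ≤ τ * D :=
      (abs_dotProduct_le_mul_sum_abs fun m => hz.abs_hatSigma_sub_le j m).trans
        (mul_le_mul_of_nonneg_left ((M.sum_abs_theta_le_Delta k).trans hD) hτ)
    have h2 : residual M z k j = (hatSigma z - M.cov).mulVec (M.theta k) j
        - ((hatMu z k j - M.mean k j) - (hatMu z 0 j - M.mean 0 j)) := by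
      simp only [residual, Matrix.sub_mulVec, M.cov_mulVec_theta, Pi.sub_apply]
      ring
    have h3 := abs_le.1 h1
    have h4 := abs_le.1 (hz.abs_hatMu_sub_le k j)
    have h5 := abs_le.1 (hz.abs_hatMu_sub_le 0 j)
    rw [h2, abs_le]
    constructor <;> linarith
  calc √(∑ k, residual M z k j ^ 2) ≤ ∑ k, |residual M z k j| :=
        sqrt_sum_sq_le fun k => residual M z k j
    _ ≤ ∑ _k : Fin K, (D + 2) * τ := Finset.sum_le_sum fun k _ => h k
    _ ≤ lam / 2 := by simpa [mul_assoc] using hlam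

/-- The penalty dominates the linear term, which makes the objective coercive even if the pooled
covariance matrix is singular. -/
theorem le_objective (hz : Close M z τ) (hD : M.Delta ≤ D)
    (hlam : K * (D + 2) * τ ≤ lam / 2) (th : Fin K → Fin p → ℝ) :
    1 / 2 * ∑ k, (th k - M.theta k) ⬝ᵥ (hatSigma z).mulVec (th k - M.theta k)
        - 1 / 2 * ∑ k, M.theta k ⬝ᵥ (hatSigma z).mulVec (M.theta k) + lam / 2 * groupNorm th ≤
      objective z lam th := by
  rw [objective_eq M]
  have := (abs_le.1 (abs_sum_dotProduct_le_groupNorm (sqrt_sum_residual_sq_le hz hD hlam) th)).1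
  linarith

theorem exists_isEstimate (hz : Close M z τ) (hD : M.Delta ≤ D)
    (hlam : K * (D + 2) * τ ≤ lam / 2) (hlam0 : 0 < lam) : ∃ th, IsEstimate z lam th := by
  have hcont : Continuous fun th : Fin K → Fin p → ℝ => objective z lam th := by
    unfold objective Matrix.mulVec dotProduct
    fun_prop
  have hnorm : ∀ th : Fin K → Fin p → ℝ, ‖th‖ ≤ groupNorm th := fun th => by
    refine (pi_norm_le_iff_of_nonneg (groupNorm_nonneg th)).2 fun k =>
      (pi_norm_le_iff_of_nonneg (groupNorm_nonneg th)).2 fun j => ?_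
    exact (Finset.single_le_sum (f := fun j => |th k j|) (fun _ _ => abs_nonneg _)
      (Finset.mem_univ j)).trans (sum_abs_le_groupNorm th k)
  set Q := ∑ k, M.theta k ⬝ᵥ (hatSigma z).mulVec (M.theta k)
  have hlow : ∀ th : Fin K → Fin p → ℝ, lam / 2 * ‖th‖ - 1 / 2 * Q ≤ objective z lam th := by
    intro th
    have h1 := le_objective hz hD hlam th
    have h2 : 0 ≤ ∑ k, (th k - M.theta k) ⬝ᵥ (hatSigma z).mulVec (th k - M.theta k) :=
      Finset.sum_nonneg fun k _ => hz.quadForm_nonneg _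
    have h3 := mul_le_mul_of_nonneg_left (hnorm th) (by positivity : 0 ≤ lam / 2)
    linarith
  have htend : Tendsto (fun th : Fin K → Fin p → ℝ => objective z lam th)
      (cocompact (Fin K → Fin p → ℝ)) atTop :=
    tendsto_atTop_mono hlow (tendsto_atTop_add_const_right _ _
      (tendsto_norm_cocompact_atTop.const_mul_atTop (by positivity)))
  have hclosed : IsClosed {th : Fin K → Fin p → ℝ | th 0 = 0} :=
    isClosed_eq (continuous_apply 0) continuous_const
  obtain ⟨th, hth, hmin⟩ := hcont.continuousOn.exists_isMinOn' hclosed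
    (x₀ := (0 : Fin K → Fin p → ℝ)) rfl
    ((htend.eventually_ge_atTop _).filter_mono inf_le_left)
  exact ⟨th, hth, fun th' h' => hmin h'⟩

/-- The basic inequality: comparing an estimate with the true directions bounds its penalty and its
prediction error. -/
theorem IsEstimate.basic_inequality (hz : Close M z τ) (hD : M.Delta ≤ D)
    (hlam : K * (D + 2) * τ ≤ lam / 2) {th : Fin K → Fin p → ℝ} (hth : IsEstimate z lam th) :
    ∑ k, (th k - M.theta k) ⬝ᵥ (hatSigma z).mulVec (th k - M.theta k) + lam * groupNorm th ≤
      3 * lam * (K * D) := by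
  have h1 := le_objective hz hD hlam th
  have h2 := hth.2 M.theta M.theta_zero
  rw [objective_eq M z lam M.theta] at h2
  have h3 := (abs_le.1
    (abs_sum_dotProduct_le_groupNorm (sqrt_sum_residual_sq_le hz hD hlam) M.theta)).2
  have hτ : 0 ≤ τ := (abs_nonneg _).trans (hz.abs_log_hatPi_sub_le 0)
  have hD0 : 0 ≤ D := M.Delta_nonneg.trans hD
  have hlam0 : 0 ≤ lam := by
    have : 0 ≤ K * (D + 2) * τ := by positivity
    linarith
  have h4 : groupNorm M.theta ≤ K * D := by
    calc groupNorm M.theta ≤ ∑ k, ∑ j, |M.theta k j| := groupNorm_le _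
      _ ≤ ∑ _k : Fin K, D := Finset.sum_le_sum fun k _ => (M.sum_abs_theta_le_Delta k).trans hD
      _ = K * D := by simp
  have h5 := mul_le_mul_of_nonneg_left h4 hlam0
  simp only [sub_self, zero_dotProduct, Finset.sum_const_zero] at h2
  linarith

theorem IsEstimate.sum_abs_le (hz : Close M z τ) (hD : M.Delta ≤ D)
    (hlam : K * (D + 2) * τ ≤ lam / 2) (hlam0 : 0 < lam) {th : Fin K → Fin p → ℝ}
    (hth : IsEstimate z lam th) (k : Fin K) : ∑ j, |th k j| ≤ 3 * (K * D) := by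
  have h1 := hth.basic_inequality hz hD hlam
  have h2 : 0 ≤ ∑ k, (th k - M.theta k) ⬝ᵥ (hatSigma z).mulVec (th k - M.theta k) :=
    Finset.sum_nonneg fun k _ => hz.quadForm_nonneg _
  refine (sum_abs_le_groupNorm th k).trans (le_of_mul_le_mul_left ?_ hlam0)
  linarith

/-- The slow rate: the squared prediction error of an estimate is of the order `λ`. No control of
the selected variables is needed for it. -/
theorem IsEstimate.quadForm_sub_le (hz : Close M z τ) (hD : M.Delta ≤ D)
    (hlam : K * (D + 2) * τ ≤ lam / 2) (hlam0 : 0 < lam) (hτ : τ ≤ lam)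
    {th : Fin K → Fin p → ℝ} (hth : IsEstimate z lam th) (k : Fin K) :
    (th k - M.theta k) ⬝ᵥ M.cov.mulVec (th k - M.theta k) ≤
      (3 * (K * D) + 16 * (K * D) ^ 2) * lam := by
  have hD0 : 0 ≤ D := M.Delta_nonneg.trans hD
  have hτ0 : 0 ≤ τ := (abs_nonneg _).trans (hz.abs_log_hatPi_sub_le 0)
  have hK : (1 : ℝ) ≤ K := by exact_mod_cast NeZero.one_le
  have h1 : ∑ j, |(th k - M.theta k) j| ≤ 4 * (K * D) := by
    calc ∑ j, |(th k - M.theta k) j| ≤ ∑ j, (|th k j| + |M.theta k j|) :=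
          Finset.sum_le_sum fun j _ => abs_sub _ _
      _ = ∑ j, |th k j| + ∑ j, |M.theta k j| := Finset.sum_add_distrib
      _ ≤ 3 * (K * D) + D := add_le_add (hth.sum_abs_le hz hD hlam hlam0 k)
          ((M.sum_abs_theta_le_Delta k).trans hD)
      _ ≤ 4 * (K * D) := by nlinarith
  have h2 := (abs_le.1 (abs_quadForm_sub_le hz (th k - M.theta k))).1
  have h3 := hth.basic_inequality hz hD hlam
  have h4 : (th k - M.theta k) ⬝ᵥ (hatSigma z).mulVec (th k - M.theta k) ≤
      ∑ k, (th k - M.theta k) ⬝ᵥ (hatSigma z).mulVec (th k - M.theta k) :=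
    Finset.single_le_sum (f := fun k => (th k - M.theta k) ⬝ᵥ (hatSigma z).mulVec (th k - M.theta k))
      (fun k _ => hz.quadForm_nonneg _) (Finset.mem_univ k)
  have h5 : 0 ≤ lam * groupNorm th := mul_nonneg hlam0.le (groupNorm_nonneg th)
  have h6 : τ * (∑ j, |(th k - M.theta k) j|) ^ 2 ≤ lam * (4 * (K * D)) ^ 2 := by gcongr
  nlinarith

end MSDA

/-! ### Excess risk of a plug-in rule -/

namespace LDAModel

variable {K p : ℕ}

theorem errorRate_eq (M : LDAModel K p) {g : EuclideanSpace ℝ (Fin p) → Fin K} (hg : Measurable g) :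
    M.errorRate g =
      ∑ k, M.prior k * ∫ x, (1 - if g x = k then (1 : ℝ) else 0) ∂(M.classLaw k) := by
  have hm : Measurable fun z : EuclideanSpace ℝ (Fin p) × Fin K =>
      1 - if g z.1 = z.2 then (1 : ℝ) else 0 :=
    measurable_from_prod_countable_left fun y => measurable_const.sub
      (Measurable.ite (hg (measurableSet_singleton y)) measurable_const measurable_const)
  have hs : MeasurableSet {z : EuclideanSpace ℝ (Fin p) × Fin K | g z.1 ≠ z.2} :=
    (measurableSet_eq_fun (hg.comp measurable_fst) measurable_snd).compl
  have hi : ∀ k, Integrable (fun x => 1 - if g x = k then (1 : ℝ) else 0) (M.classLaw k) := fun k =>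
    Integrable.of_bound (C := 1) (hm.comp measurable_prodMk_right).aestronglyMeasurable
      (ae_of_all _ fun x => by by_cases h : g x = k <;> simp [h])
  rw [← (M.law_integral hm hi).2, errorRate, ← integral_indicator_one hs]
  refine integral_congr_ae (ae_of_all _ fun z => ?_)
  by_cases h : g z.1 = z.2 <;> simp [h, Set.indicator]

theorem bayesError_le (M : LDAModel K p) {g : EuclideanSpace ℝ (Fin p) → Fin K}
    (hg : Measurable g) : M.bayesError ≤ M.errorRate g :=
  ciInf_le (f := fun g : {g : EuclideanSpace ℝ (Fin p) → Fin K // Measurable g} => M.errorRate g.1)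
    ⟨0, by rintro _ ⟨g, rfl⟩; exact measureReal_nonneg⟩ ⟨g, hg⟩

theorem abs_errorRate_sub_bayesError_le (M : LDAModel K p)
    {g : EuclideanSpace ℝ (Fin p) → Fin K} (hg : Measurable g) {r : ℝ}
    (h : ∀ g', Measurable g' → M.errorRate g - M.errorRate g' ≤ r) :
    |M.errorRate g - M.bayesError| ≤ r := by
  have : Nonempty {g : EuclideanSpace ℝ (Fin p) → Fin K // Measurable g} := ⟨⟨g, hg⟩⟩
  rw [abs_of_nonneg (sub_nonneg.2 (M.bayesError_le hg)), sub_le_comm]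
  exact le_ciInf fun g' => by linarith [h g'.1 g'.2]

theorem errorRate_mem_Icc (M : LDAModel K p) (g : EuclideanSpace ℝ (Fin p) → Fin K) :
    M.errorRate g ∈ Set.Icc 0 1 := ⟨measureReal_nonneg, measureReal_le_one⟩

/-- Cauchy–Schwarz for the quadratic form of the covariance matrix. -/
theorem abs_dotProduct_cov_le (M : LDAModel K p) (u w : Fin p → ℝ) :
    |M.cov.mulVec u ⬝ᵥ w| ≤ √(u ⬝ᵥ M.cov.mulVec u) * √(w ⬝ᵥ M.cov.mulVec w) := by
  rw [← Real.sqrt_mul (M.quadForm_nonneg u)]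
  refine Real.abs_le_sqrt ?_
  have hsym : M.cov.IsSymm := by simpa using M.cov_posDef.isHermitian
  have h1 : u ⬝ᵥ M.cov.mulVec w = M.cov.mulVec u ⬝ᵥ w := by
    rw [Matrix.dotProduct_mulVec, ← Matrix.mulVec_transpose, hsym.eq]
  have h2 : w ⬝ᵥ M.cov.mulVec u = M.cov.mulVec u ⬝ᵥ w := dotProduct_comm _ _
  have h := discrim_le_zero (a := u ⬝ᵥ M.cov.mulVec u) (b := 2 * (M.cov.mulVec u ⬝ᵥ w))
    (c := w ⬝ᵥ M.cov.mulVec w) fun t => by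
      have := M.quadForm_nonneg (t • u + w)
      simp only [Matrix.mulVec_add, Matrix.mulVec_smul, add_dotProduct, dotProduct_add,
        smul_dotProduct, dotProduct_smul, smul_eq_mul, h1, h2] at this
      linarith
  rw [discrim] at h
  linarith

/-- An affine function of the predictors is bounded in mean by its standard deviation and its
mean. -/
theorem integral_abs_affine_le (M : LDAModel K p) (k : Fin K) (u : Fin p → ℝ) (β : ℝ) :
    Integrable (fun x => |∑ j, (x j - M.mean k j) * u j + β|) (M.classLaw k) ∧
    ∫ x, |∑ j, (x j - M.mean k j) * u j + β| ∂(M.classLaw k) ≤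
      √(u ⬝ᵥ M.cov.mulVec u) + |β| := by
  have h1 := integrable_abs_gaussianReal (u ⬝ᵥ M.cov.mulVec u).toNNReal
  have h2 := integral_abs_gaussianReal_le (u ⬝ᵥ M.cov.mulVec u).toNNReal
  rw [← M.map_classLaw k, integrable_map_measure (by fun_prop) (by fun_prop)] at h1
  simp only [Function.comp_def] at h1
  rw [← M.map_classLaw k, integral_map (by fun_prop) (by fun_prop),
    Real.coe_toNNReal _ (M.quadForm_nonneg u)] at h2
  have h3 : Integrable (fun x => |∑ j, (x j - M.mean k j) * u j| + |β|) (M.classLaw k) :=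
    h1.add (integrable_const _)
  have h4 : Integrable (fun x => |∑ j, (x j - M.mean k j) * u j + β|) (M.classLaw k) :=
    h3.mono' (by fun_prop) (ae_of_all _ fun x => by
      rw [Real.norm_eq_abs, abs_abs]; exact abs_add_le _ _)
  refine ⟨h4, ?_⟩
  calc ∫ x, |∑ j, (x j - M.mean k j) * u j + β| ∂(M.classLaw k)
      ≤ ∫ x, (|∑ j, (x j - M.mean k j) * u j| + |β|) ∂(M.classLaw k) :=
        integral_mono h4 h3 fun x => abs_add_le _ _
    _ = ∫ x, |∑ j, (x j - M.mean k j) * u j| ∂(M.classLaw k) + |β| := by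
        rw [integral_add h1 (integrable_const _)]; simp
    _ ≤ _ := by gcongr

variable [NeZero K]

/-- The population discriminant score of class `k` at `x`. -/
def trueScore (M : LDAModel K p) (x : EuclideanSpace ℝ (Fin p)) (k : Fin K) : ℝ :=
  ∑ j, (x j - (M.mean k j + M.mean 0 j) / 2) * M.theta k j + Real.log (M.prior k)

theorem classLaw_eq_tilted (M : LDAModel K p) (k : Fin K) :
    M.classLaw k = (M.classLaw 0).tilted (fun x => ∑ j, x j * M.theta k j) := by
  rw [classLaw, classLaw, tilted_multivariateGaussian M.cov_posDef.posSemidef, cov_mulVec_theta,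
    add_sub_cancel]

theorem exp_trueScore (M : LDAModel K p) {k : Fin K} (hk : 0 < M.prior k)
    (x : EuclideanSpace ℝ (Fin p)) :
    M.prior k * (Real.exp (∑ j, x j * M.theta k j) /
      ∫ x, Real.exp (∑ j, x j * M.theta k j) ∂(M.classLaw 0)) = Real.exp (M.trueScore x k) := by
  rw [classLaw, integral_exp_sum_mul_multivariateGaussian M.cov_posDef.posSemidef, ← Real.exp_sub,
    trueScore, add_comm (∑ j, _) (Real.log _), Real.exp_add, Real.exp_log hk, cov_mulVec_theta]
  congr 2
  simp only [dotProduct, Finset.sum_div, ← Finset.sum_add_distrib, ← Finset.sum_sub_distrib]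
  exact Finset.sum_congr rfl fun j _ => by simp; ring

/-- `x ↦ exp (trueScore x k)` is the density of class `k`, weighted by its prior probability, with
respect to the law of the predictors in the first class. -/
theorem integral_classLaw (M : LDAModel K p) {k : Fin K} (hk : 0 < M.prior k)
    {f : EuclideanSpace ℝ (Fin p) → ℝ} (hf : Integrable f (M.classLaw k)) :
    Integrable (fun x => Real.exp (M.trueScore x k) * f x) (M.classLaw 0) ∧
      ∫ x, Real.exp (M.trueScore x k) * f x ∂(M.classLaw 0) =
        M.prior k * ∫ x, f x ∂(M.classLaw k) := by
  have hint : Integrable (fun x : EuclideanSpace ℝ (Fin p) => Real.exp (∑ j, x j * M.theta k j))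
      (M.classLaw 0) :=
    integrable_exp_sum_mul_multivariateGaussian M.cov_posDef.posSemidef _ _
  have hpt : ∀ x, Real.exp (M.trueScore x k) * f x =
      M.prior k * ((Real.exp (∑ j, x j * M.theta k j) /
        ∫ x, Real.exp (∑ j, x j * M.theta k j) ∂(M.classLaw 0)) * f x) := fun x => by
    rw [← M.exp_trueScore hk, mul_assoc]
  simp_rw [hpt]
  rw [M.classLaw_eq_tilted k] at hf
  rw [integrable_tilted_iff hint] at hf
  constructor
  · refine Integrable.const_mul ?_ _
    simpa [div_mul_eq_mul_div] using hf.div_const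
      (∫ x, Real.exp (∑ j, x j * M.theta k j) ∂(M.classLaw 0))
  · rw [integral_const_mul]
    conv_rhs => rw [M.classLaw_eq_tilted k, integral_tilted]
    rfl

/-- Excess risk bound: a plug-in rule, which maximizes scores `σ`, loses against any other rule at
most twice the mean total error of the scores, because `exp a - exp b ≤ exp a * (a - b)` for the
weighted densities `exp a`, `exp b` of the two chosen classes. -/
theorem errorRate_sub_le (M : LDAModel K p) (hprior : ∀ k, 0 < M.prior k)
    {σ : EuclideanSpace ℝ (Fin p) → Fin K → ℝ} {g g' : EuclideanSpace ℝ (Fin p) → Fin K}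
    (hg : Measurable g) (hg' : Measurable g') (hmax : ∀ x k, σ x k ≤ σ x (g x)) {r : ℝ}
    (hσ : ∀ k l, Integrable (fun x => |σ x l - M.trueScore x l|) (M.classLaw k) ∧
      ∫ x, |σ x l - M.trueScore x l| ∂(M.classLaw k) ≤ r) :
    M.errorRate g - M.errorRate g' ≤ 2 * K * r := by
  set E : EuclideanSpace ℝ (Fin p) → ℝ := fun x => 2 * ∑ l, |σ x l - M.trueScore x l| with hE
  have hEint : ∀ k, Integrable E (M.classLaw k) := fun k =>
    (integrable_finsetSum _ fun l _ => (hσ k l).1).const_mul 2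
  have hEle : ∀ k, ∫ x, E x ∂(M.classLaw k) ≤ 2 * K * r := fun k => by
    rw [hE, integral_const_mul, integral_finsetSum _ fun l _ => (hσ k l).1]
    calc 2 * ∑ l, ∫ x, |σ x l - M.trueScore x l| ∂(M.classLaw k) ≤ 2 * ∑ _l : Fin K, r := by
          gcongr with l
          exact (hσ k l).2
      _ = 2 * K * r := by simp; ring
  set D : Fin K → EuclideanSpace ℝ (Fin p) → ℝ := fun k x =>
    (if g' x = k then (1 : ℝ) else 0) - if g x = k then (1 : ℝ) else 0 with hD
  have hmeas : ∀ {h : EuclideanSpace ℝ (Fin p) → Fin K}, Measurable h → ∀ k,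
      Measurable fun x => if h x = k then (1 : ℝ) else 0 := fun hh k =>
    Measurable.ite (hh (measurableSet_singleton k)) measurable_const measurable_const
  have hind : ∀ {h : EuclideanSpace ℝ (Fin p) → Fin K}, Measurable h → ∀ k,
      Integrable (fun x => if h x = k then (1 : ℝ) else 0) (M.classLaw k) := fun {h} hh k =>
    Integrable.of_bound (C := 1) (hmeas hh k).aestronglyMeasurable
      (ae_of_all _ fun x => by by_cases hx : h x = k <;> simp [hx])
  have hcompl : ∀ {h : EuclideanSpace ℝ (Fin p) → Fin K}, Measurable h → ∀ k,
      Integrable (fun x => 1 - if h x = k then (1 : ℝ) else 0) (M.classLaw k) := fun hh k =>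
    (integrable_const _).sub (hind hh k)
  have hDint : ∀ k, Integrable (D k) (M.classLaw k) := fun k => (hind hg' k).sub (hind hg k)
  have hdiff : M.errorRate g - M.errorRate g' = ∑ k, M.prior k * ∫ x, D k x ∂(M.classLaw k) := by
    rw [M.errorRate_eq hg, M.errorRate_eq hg', ← Finset.sum_sub_distrib]
    refine Finset.sum_congr rfl fun k _ => ?_
    rw [← mul_sub, ← integral_sub (hcompl hg k) (hcompl hg' k)]
    congr 2
    funext x
    simp only [hD]; ring
  have hpt : ∀ x, ∑ k, Real.exp (M.trueScore x k) * D k x ≤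
      ∑ k, Real.exp (M.trueScore x k) * E x := fun x => by
    have h1 : ∑ k, Real.exp (M.trueScore x k) * D k x =
        Real.exp (M.trueScore x (g' x)) - Real.exp (M.trueScore x (g x)) := by
      simp [hD, mul_sub, Finset.sum_sub_distrib]
    have hsingle : ∀ l, |σ x l - M.trueScore x l| ≤ ∑ l, |σ x l - M.trueScore x l| := fun l =>
      Finset.single_le_sum (f := fun l => |σ x l - M.trueScore x l|) (fun _ _ => abs_nonneg _)
        (Finset.mem_univ l)
    have h2 : M.trueScore x (g' x) - M.trueScore x (g x) ≤ E x := by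
      have ha := (abs_le.1 (hsingle (g' x))).1
      have hb := (abs_le.1 (hsingle (g x))).2
      have hc := hmax x (g' x)
      simp only [hE]
      linarith
    have hE0 : 0 ≤ E x := mul_nonneg (by norm_num) (Finset.sum_nonneg fun _ _ => abs_nonneg _)
    have h3 := Real.add_one_le_exp (M.trueScore x (g x) - M.trueScore x (g' x))
    have h4 : Real.exp (M.trueScore x (g x)) = Real.exp (M.trueScore x (g' x)) *
        Real.exp (M.trueScore x (g x) - M.trueScore x (g' x)) := by
      rw [← Real.exp_add]; congr 1; ring
    have h5 : 0 < Real.exp (M.trueScore x (g' x)) := Real.exp_pos _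
    rw [h1]
    calc Real.exp (M.trueScore x (g' x)) - Real.exp (M.trueScore x (g x))
        ≤ Real.exp (M.trueScore x (g' x)) * E x := by rw [h4]; nlinarith
      _ ≤ ∑ k, Real.exp (M.trueScore x k) * E x :=
        Finset.single_le_sum (f := fun k => Real.exp (M.trueScore x k) * E x)
          (fun k _ => mul_nonneg (Real.exp_pos _).le hE0) (Finset.mem_univ _)
  calc M.errorRate g - M.errorRate g'
      = ∫ x, ∑ k, Real.exp (M.trueScore x k) * D k x ∂(M.classLaw 0) := by
        rw [hdiff, integral_finsetSum _ fun k _ => (M.integral_classLaw (hprior k) (hDint k)).1]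
        exact Finset.sum_congr rfl fun k _ => (M.integral_classLaw (hprior k) (hDint k)).2.symm
    _ ≤ ∫ x, ∑ k, Real.exp (M.trueScore x k) * E x ∂(M.classLaw 0) :=
        integral_mono
          (integrable_finsetSum _ fun k _ => (M.integral_classLaw (hprior k) (hDint k)).1)
          (integrable_finsetSum _ fun k _ => (M.integral_classLaw (hprior k) (hEint k)).1) hpt
    _ = ∑ k, M.prior k * ∫ x, E x ∂(M.classLaw k) := by
        rw [integral_finsetSum _ fun k _ => (M.integral_classLaw (hprior k) (hEint k)).1]
        exact Finset.sum_congr rfl fun k _ => (M.integral_classLaw (hprior k) (hEint k)).2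
    _ ≤ ∑ k, M.prior k * (2 * K * r) :=
        Finset.sum_le_sum fun k _ => mul_le_mul_of_nonneg_left (hEle k) (M.prior_nonneg k)
    _ = 2 * K * r := by rw [← Finset.sum_mul, M.prior_sum, one_mul]

end LDAModel

namespace MSDA

variable {K p n : ℕ} [NeZero K]

variable {M : LDAModel K p} {z : Fin n → EuclideanSpace ℝ (Fin p) × Fin K} {τ D lam : ℝ}

/-- Around the mean of class `k`, the error of the score of class `l` is a linear function with the
error of the direction as coefficients, up to a constant. -/
theorem score_sub_trueScore (M : LDAModel K p) (z : Fin n → EuclideanSpace ℝ (Fin p) × Fin K)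
    (th : Fin K → Fin p → ℝ) (k l : Fin K) (x : EuclideanSpace ℝ (Fin p)) :
    score z th x l - M.trueScore x l =
      ∑ j, (x j - M.mean k j) * (th l - M.theta l) j +
        (M.cov.mulVec (M.theta k) ⬝ᵥ (th l - M.theta l)
          - M.cov.mulVec (M.theta l) ⬝ᵥ (th l - M.theta l) / 2
          - (hatMu z l - M.mean l) ⬝ᵥ th l / 2 - (hatMu z 0 - M.mean 0) ⬝ᵥ th l / 2
          + (Real.log (hatPi z l) - Real.log (M.prior l))) := by
  simp only [M.cov_mulVec_theta, score, LDAModel.trueScore, dotProduct, Pi.sub_apply,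
    Finset.sum_div]
  have h : ∀ a b : ℝ, ∀ A B C G H I J : Fin p → ℝ,
      (∀ j, A j - B j = C j + (G j - H j - I j - J j)) →
      (∑ j, A j + a) - (∑ j, B j + b) =
        ∑ j, C j + (∑ j, G j - ∑ j, H j - ∑ j, I j - ∑ j, J j + (a - b)) := by
    intro a b A B C G H I J hA
    have := Finset.sum_congr (rfl : (Finset.univ : Finset (Fin p)) = Finset.univ) fun j _ => hA j
    simp only [Finset.sum_add_distrib, Finset.sum_sub_distrib] at this
    linarith
  exact h _ _ _ _ _ _ _ _ _ fun j => by ring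

/-- On a good sample the excess risk of every fitted rule is of the order `√λ`. -/
theorem abs_errorRate_sub_bayesError_le (hz : Close M z τ) (hprior : ∀ k, 0 < M.prior k)
    (hD : M.Delta ≤ D) (hlam : K * (D + 2) * τ ≤ lam / 2) (hlam0 : 0 < lam) (hlam1 : lam ≤ 1)
    (hτ : τ ≤ lam) {th : Fin K → Fin p → ℝ} (hth : IsEstimate z lam th)
    {g : EuclideanSpace ℝ (Fin p) → Fin K} (hg : IsFittedRule z th g) :
    |M.errorRate g - M.bayesError| ≤
      2 * K * ((1 + 3 * D) * √(3 * (K * D) + 16 * (K * D) ^ 2) + 3 * (K * D) + 1) * √lam := by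
  set A := 3 * (K * D) + 16 * (K * D) ^ 2
  have hD0 : 0 ≤ D := M.Delta_nonneg.trans hD
  have hA0 : 0 ≤ A := by positivity
  have hτ0 : 0 ≤ τ := (abs_nonneg _).trans (hz.abs_log_hatPi_sub_le 0)
  have hτs : τ ≤ √lam := hτ.trans (Real.le_sqrt_of_sq_le (by nlinarith))
  have hKD : 0 ≤ K * D := by positivity
  have hh : ∀ l, √((th l - M.theta l) ⬝ᵥ M.cov.mulVec (th l - M.theta l)) ≤ √A * √lam := fun l => by
    rw [← Real.sqrt_mul hA0]
    exact Real.sqrt_le_sqrt (hth.quadForm_sub_le hz hD hlam hlam0 hτ l)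
  have hθ : ∀ k, √(M.theta k ⬝ᵥ M.cov.mulVec (M.theta k)) ≤ 2 * D := fun k => by
    rw [Real.sqrt_le_left (by positivity), M.cov_mulVec_theta]
    have h1 : |(M.mean k - M.mean 0) ⬝ᵥ M.theta k| ≤ 2 * D * ∑ j, |M.theta k j| :=
      abs_dotProduct_le_mul_sum_abs fun j => by
        have h2 : ∀ k, |M.mean k j| ≤ D := fun k =>
          (Finset.single_le_sum (f := fun j => |M.mean k j|) (fun _ _ => abs_nonneg _)
            (Finset.mem_univ j)).trans ((M.sum_abs_mean_le_Delta k).trans hD)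
        rw [Pi.sub_apply]
        linarith [abs_sub (M.mean k j) (M.mean 0 j), h2 k, h2 0]
    have h3 := (M.sum_abs_theta_le_Delta k).trans hD
    rw [dotProduct_comm]
    nlinarith [le_abs_self ((M.mean k - M.mean 0) ⬝ᵥ M.theta k)]
  have hcross : ∀ k l, |M.cov.mulVec (M.theta k) ⬝ᵥ (th l - M.theta l)| ≤ 2 * D * (√A * √lam) :=
    fun k l => (M.abs_dotProduct_cov_le _ _).trans
      (mul_le_mul (hθ k) (hh l) (Real.sqrt_nonneg _) (by positivity))
  have hmu : ∀ k l, |(hatMu z k - M.mean k) ⬝ᵥ th l| ≤ √lam * (3 * (K * D)) := fun k l =>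
    (abs_dotProduct_le_mul_sum_abs fun j => hz.abs_hatMu_sub_le k j).trans
      (mul_le_mul hτs (hth.sum_abs_le hz hD hlam hlam0 l)
        (Finset.sum_nonneg fun _ _ => abs_nonneg _) (Real.sqrt_nonneg _))
  refine M.abs_errorRate_sub_bayesError_le hg.1 fun g' hg' => ?_
  rw [mul_assoc]
  refine M.errorRate_sub_le hprior hg.1 hg' hg.2 fun k l => ?_
  simp_rw [score_sub_trueScore M z th k l]
  obtain ⟨h1, h2⟩ := M.integral_abs_affine_le k (th l - M.theta l)
    (M.cov.mulVec (M.theta k) ⬝ᵥ (th l - M.theta l)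
      - M.cov.mulVec (M.theta l) ⬝ᵥ (th l - M.theta l) / 2
      - (hatMu z l - M.mean l) ⬝ᵥ th l / 2 - (hatMu z 0 - M.mean 0) ⬝ᵥ th l / 2
      + (Real.log (hatPi z l) - Real.log (M.prior l)))
  refine ⟨h1, h2.trans ?_⟩
  have e1 := abs_le.1 (hcross k l)
  have e2 := abs_le.1 (hcross l l)
  have e3 := abs_le.1 (hmu l l)
  have e4 := abs_le.1 (hmu 0 l)
  have e5 := abs_le.1 ((hz.abs_log_hatPi_sub_le l).trans hτs)
  have e6 := hh l
  have : |M.cov.mulVec (M.theta k) ⬝ᵥ (th l - M.theta l)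
      - M.cov.mulVec (M.theta l) ⬝ᵥ (th l - M.theta l) / 2
      - (hatMu z l - M.mean l) ⬝ᵥ th l / 2 - (hatMu z 0 - M.mean 0) ⬝ᵥ th l / 2
      + (Real.log (hatPi z l) - Real.log (M.prior l))| ≤
      3 * D * (√A * √lam) + √lam * (3 * (K * D)) + √lam := by
    rw [abs_le]; constructor <;> linarith
  calc _ ≤ √A * √lam + (3 * D * (√A * √lam) + √lam * (3 * (K * D)) + √lam) := add_le_add e6 this
    _ = _ := by ring

theorem ErrorWithin.mono {r r' : ℝ} (h : ErrorWithin M z lam r) (hr : r ≤ r') :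
    ErrorWithin M z lam r' :=
  ⟨h.1, fun th hth g hg => (h.2 th hth g hg).trans hr⟩

theorem Close.errorWithin (hz : Close M z τ) (hprior : ∀ k, 0 < M.prior k)
    (hD : M.Delta ≤ D) (hlam : K * (D + 2) * τ ≤ lam / 2) (hlam0 : 0 < lam) (hτ : τ ≤ lam)
    {M₁ : ℝ} (hM₁ : 1 ≤ M₁)
    (hM : 2 * K * ((1 + 3 * D) * √(3 * (K * D) + 16 * (K * D) ^ 2) + 3 * (K * D) + 1) ≤ M₁) :
    ErrorWithin M z lam (M₁ * lam ^ (1 / 3 : ℝ)) := by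
  refine ⟨exists_isEstimate hz hD hlam hlam0, fun th hth g hg => ?_⟩
  rcases le_or_gt lam 1 with h1 | h1
  · refine (abs_errorRate_sub_bayesError_le hz hprior hD hlam hlam0 h1 hτ hth hg).trans ?_
    refine mul_le_mul hM ?_ (Real.sqrt_nonneg _) (by linarith)
    rw [Real.sqrt_eq_rpow]
    exact Real.rpow_le_rpow_of_exponent_ge hlam0 h1 (by norm_num)
  · have h2 : 1 ≤ M₁ * lam ^ (1 / 3 : ℝ) :=
      one_le_mul_of_one_le_of_one_le hM₁ (Real.one_le_rpow h1.le (by norm_num))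
    refine (M.abs_errorRate_sub_bayesError_le hg.1 fun g' _ => ?_).trans h2
    linarith [(M.errorRate_mem_Icc g).2, (M.errorRate_mem_Icc g').1]

end MSDA

/-! ### Good samples have high probability -/

namespace MSDA

variable {K p n : ℕ}

/-- The index set of the averages that have to be controlled: class frequencies, class means, and
the second moments of `X_l + X_m` and `X_l - X_m`. -/
abbrev StatIdx (K p : ℕ) : Type := Fin K ⊕ (Fin K × Fin p) ⊕ (Fin p × Fin p × ℤˣ)

/-- The centred summands of the averages indexed by `StatIdx`. -/
def stat (M : LDAModel K p) : StatIdx K p → EuclideanSpace ℝ (Fin p) × Fin K → ℝ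
  | .inl k => fun z => (if z.2 = k then (1 : ℝ) else 0) - M.prior k
  | .inr (.inl (k, j)) => fun z => if z.2 = k then z.1 j - M.mean k j else 0
  | .inr (.inr (l, m, r)) => fun z =>
      (∑ j, (z.1 j - M.mean z.2 j) *
        (Pi.single l 1 + ((r : ℤ) : ℝ) • Pi.single m 1 : Fin p → ℝ) j) ^ 2 -
      (Pi.single l 1 + ((r : ℤ) : ℝ) • Pi.single m 1 : Fin p → ℝ) ⬝ᵥ
        M.cov.mulVec (Pi.single l 1 + ((r : ℤ) : ℝ) • Pi.single m 1)

theorem hasExpBound_stat (M : LDAModel K p) {v : ℝ} (hv : ∀ j, M.cov j j ≤ v) (hv1 : 1 ≤ v)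
    (t : StatIdx K p) : HasExpBound (stat M t) M.law (64 * v ^ 2) (1 / (16 * v)) := by
  rcases t with k | ⟨k, j⟩ | ⟨l, m, r⟩
  · exact (M.hasExpBound_label k (1 / (16 * v))).mono (by nlinarith) le_rfl
  · exact (M.hasExpBound_coord k j (1 / (16 * v)) (hv j)).mono (by nlinarith) le_rfl
  · have hw : (Pi.single l 1 + ((r : ℤ) : ℝ) • Pi.single m 1 : Fin p → ℝ) ⬝ᵥ
        M.cov.mulVec (Pi.single l 1 + ((r : ℤ) : ℝ) • Pi.single m 1) ≤ 4 * v := by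
      rw [M.quadForm_single_add]
      have := abs_le.1 (M.abs_cov_le hv l m)
      have := hv l
      have := hv m
      rcases Int.units_eq_one_or r with rfl | rfl <;> simp <;> linarith
    exact (M.hasExpBound_sq _ hw (by linarith)).mono (le_of_eq (by ring)) (le_of_eq (by ring))

theorem measure_exists_stat_ge_le (M : LDAModel K p) {v : ℝ} (hv : ∀ j, M.cov j j ≤ v)
    (hv1 : 1 ≤ v) (hp : 0 < p) (n : ℕ) {s q : ℝ} (hs : 0 ≤ s) (hsq : s ≤ q) :
    (M.sampleLaw n).real {z | ∃ t, n * s ≤ |∑ i, stat M t (z i)|} ≤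
      (4 * K + 4) * (p : ℝ) ^ 2 * Real.exp (-(n * s ^ 2 / (4 * (64 * v ^ 2 + 8 * v * q)))) := by
  have hq : 0 ≤ q := hs.trans hsq
  have hV : 0 < 64 * v ^ 2 + 8 * v * q := by positivity
  have h1 : ∀ t, (M.sampleLaw n).real {z | n * s ≤ |∑ i, stat M t (z i)|} ≤
      2 * Real.exp (-(n * s ^ 2 / (4 * (64 * v ^ 2 + 8 * v * q)))) := fun t =>
    ((hasExpBound_stat M hv hv1 t).mono (V' := 64 * v ^ 2 + 8 * v * q)
      (le_add_of_nonneg_right (by positivity)) le_rfl).pi_abs_sum_ge_le hV n hs (by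
        have : 2 * (64 * v ^ 2 + 8 * v * q) * (1 / (16 * v)) = 8 * v + q := by
          field_simp; ring
        rw [this]; linarith)
  have hset : {z : Fin n → EuclideanSpace ℝ (Fin p) × Fin K |
      ∃ t, n * s ≤ |∑ i, stat M t (z i)|} = ⋃ t, {z | n * s ≤ |∑ i, stat M t (z i)|} := by
    ext z; simp
  rw [hset]
  refine (measureReal_iUnion_fintype_le _).trans ((Finset.sum_le_sum fun t _ => h1 t).trans ?_)
  rw [Finset.sum_const, Finset.card_univ, nsmul_eq_mul, ← mul_assoc]
  refine mul_le_mul_of_nonneg_right ?_ (Real.exp_pos _).le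
  have hp1 : (1 : ℝ) ≤ p := by exact_mod_cast hp
  have hK0 : (0 : ℝ) ≤ K := K.cast_nonneg
  have hcard : Fintype.card ℤˣ = 2 := rfl
  simp only [Fintype.card_sum, Fintype.card_prod, Fintype.card_fin, hcard, Nat.cast_add,
    Nat.cast_mul, Nat.cast_ofNat]
  nlinarith [mul_nonneg hK0 (sub_nonneg.2 hp1),
    mul_nonneg hK0 (mul_nonneg (sub_nonneg.2 hp1) (zero_le_one.trans hp1))]

theorem card_classIdx_eq (z : Fin n → EuclideanSpace ℝ (Fin p) × Fin K) (k : Fin K) :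
    ((classIdx z k).card : ℝ) = ∑ i, if (z i).2 = k then (1 : ℝ) else 0 := by
  simp [classIdx, Finset.sum_boole]

theorem sum_card_classIdx (z : Fin n → EuclideanSpace ℝ (Fin p) × Fin K) :
    ∑ k, ((classIdx z k).card : ℝ) = n := by
  simp_rw [card_classIdx_eq]
  rw [Finset.sum_comm]
  simp

theorem sum_sum_classIdx (z : Fin n → EuclideanSpace ℝ (Fin p) × Fin K)
    (F : Fin n → Fin K → ℝ) : ∑ k, ∑ i ∈ classIdx z k, F i k = ∑ i, F i (z i).2 := by
  simp_rw [classIdx, Finset.sum_filter]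
  rw [Finset.sum_comm]
  simp

open Matrix in
theorem hatSigma_posSemidef (z : Fin n → EuclideanSpace ℝ (Fin p) × Fin K) (hn : K ≤ n) :
    (hatSigma z).PosSemidef := by
  have h : hatSigma z = ((n : ℝ) - K)⁻¹ • ∑ k, ∑ i ∈ classIdx z k,
      vecMulVec (fun l => (z i).1 l - hatMu z k l) (star fun l => (z i).1 l - hatMu z k l) := by
    ext l m
    simp [hatSigma, Matrix.sum_apply, vecMulVec_apply, div_eq_inv_mul]
  rw [h]
  refine PosSemidef.smul ?_ (inv_nonneg.2 (sub_nonneg.2 (by exact_mod_cast hn)))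
  exact posSemidef_sum _ fun k _ => posSemidef_sum _ fun i _ => posSemidef_vecMulVec_self_star _

/-- The within-class scatter about the class means, in terms of the scatter about the true means. -/
theorem sum_centred_eq (M : LDAModel K p) (z : Fin n → EuclideanSpace ℝ (Fin p) × Fin K)
    {k : Fin K} (hk : ((classIdx z k).card : ℝ) ≠ 0) (l m : Fin p) :
    ∑ i ∈ classIdx z k, ((z i).1 l - hatMu z k l) * ((z i).1 m - hatMu z k m) =
      ∑ i ∈ classIdx z k, ((z i).1 l - M.mean k l) * ((z i).1 m - M.mean k m) -
        (classIdx z k).card * ((hatMu z k l - M.mean k l) * (hatMu z k m - M.mean k m)) := by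
  have hsum : ∀ j, ∑ i ∈ classIdx z k, (z i).1 j = (classIdx z k).card * hatMu z k j := fun j => by
    rw [hatMu]; field_simp
  simp only [sub_mul, mul_sub, Finset.sum_sub_distrib, ← Finset.mul_sum, ← Finset.sum_mul, hsum,
    Finset.sum_const, nsmul_eq_mul]
  ring

/-- If all the averages indexed by `StatIdx` are small, the sample is good. -/
theorem close_of_stat_lt {M : LDAModel K p} {z : Fin n → EuclideanSpace ℝ (Fin p) × Fin K}
    {s q v τ : ℝ} (hs : 0 ≤ s) (hq : 0 < q) (hprior : ∀ k, 2 * q ≤ M.prior k) (hsq : s ≤ q)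
    (hv : ∀ j, M.cov j j ≤ v) (hn0 : 0 < n) (hn : 2 * K ≤ n) (hτ1 : s / q ≤ τ)
    (hτ2 : s + 2 * (s / q) ^ 2 + 2 * K * v / n ≤ τ)
    (h : ∀ t, |∑ i, stat M t (z i)| < n * s) : Close M z τ := by
  have hn0' : (0 : ℝ) < n := by exact_mod_cast hn0
  have hn' : 2 * (K : ℝ) ≤ n := by exact_mod_cast hn
  have hpi : ∀ k, |hatPi z k - M.prior k| ≤ s := fun k => by
    have h1 := (h (.inl k)).le
    simp only [stat, Finset.sum_sub_distrib, Finset.sum_const, Finset.card_univ, Fintype.card_fin,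
      nsmul_eq_mul, ← card_classIdx_eq] at h1
    have h2 : hatPi z k - M.prior k = ((classIdx z k).card - n * M.prior k) / n := by
      rw [hatPi]; field_simp
    rw [h2, abs_div, abs_of_pos hn0', div_le_iff₀ hn0', mul_comm s]
    exact h1
  have hpiq : ∀ k, q ≤ hatPi z k := fun k => by
    linarith [(abs_le.1 (hpi k)).1, hprior k]
  have hcard : ∀ k, n * q ≤ (classIdx z k).card := fun k => by
    have := hpiq k
    rw [hatPi, le_div_iff₀ hn0'] at this
    linarith
  have hcard0 : ∀ k, (0 : ℝ) < (classIdx z k).card := fun k =>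
    (mul_pos hn0' hq).trans_le (hcard k)
  have hmu : ∀ k j, |hatMu z k j - M.mean k j| ≤ s / q := fun k j => by
    have h1 := (h (.inr (.inl (k, j)))).le
    simp only [stat, ← Finset.sum_filter] at h1
    have h2 : hatMu z k j - M.mean k j =
        (∑ i ∈ Finset.univ.filter fun i => (z i).2 = k, ((z i).1 j - M.mean k j)) /
          (classIdx z k).card := by
      have := (hcard0 k).ne'
      rw [hatMu, Finset.sum_sub_distrib, Finset.sum_const, nsmul_eq_mul]
      unfold classIdx at this ⊢
      field_simp
    rw [h2, abs_div, abs_of_pos (hcard0 k), div_le_div_iff₀ (hcard0 k) hq]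
    calc _ ≤ n * s * q := mul_le_mul_of_nonneg_right h1 hq.le
      _ = s * (n * q) := by ring
      _ ≤ s * (classIdx z k).card := mul_le_mul_of_nonneg_left (hcard k) hs
  refine ⟨fun k j => (hmu k j).trans hτ1, fun l m => ?_, fun k => ?_, fun u => ?_⟩
  · have hS : ∀ r : ℤˣ, |∑ i, ((((z i).1 l - M.mean (z i).2 l) +
        ((r : ℤ) : ℝ) * ((z i).1 m - M.mean (z i).2 m)) ^ 2 -
        (M.cov l l + 2 * ((r : ℤ) : ℝ) * M.cov l m + ((r : ℤ) : ℝ) ^ 2 * M.cov m m))| ≤ n * s :=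
      fun r => by
        have h1 := (h (.inr (.inr (l, m, r)))).le
        have h2 : ∀ a : Fin p → ℝ,
            ∑ j, a j * (Pi.single l 1 + ((r : ℤ) : ℝ) • Pi.single m 1 : Fin p → ℝ) j =
              a l + ((r : ℤ) : ℝ) * a m := fun a => by
          simp [mul_add, Finset.sum_add_distrib, Pi.single_apply, mul_comm]
        simp only [stat, M.quadForm_single_add] at h1
        simp only [h2 fun j => (z _).1 j - M.mean (z _).2 j] at h1
        exact h1
    have hp1 := abs_le.1 (hS 1)
    have hm1 := abs_le.1 (hS (-1))
    set T := ∑ k, (classIdx z k).card * ((hatMu z k l - M.mean k l) * (hatMu z k m - M.mean k m))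
    have hTle : |T| ≤ n * (s / q) ^ 2 := by
      calc |T| ≤ ∑ k, ((classIdx z k).card : ℝ) * (s / q) ^ 2 := by
            refine (Finset.abs_sum_le_sum_abs _ _).trans (Finset.sum_le_sum fun k _ => ?_)
            rw [abs_mul, abs_mul, abs_of_pos (hcard0 k), sq]
            exact mul_le_mul_of_nonneg_left (mul_le_mul (hmu k l) (hmu k m) (abs_nonneg _)
              (by positivity)) (hcard0 k).le
        _ = n * (s / q) ^ 2 := by rw [← Finset.sum_mul, sum_card_classIdx]
    set P := ∑ i, ((z i).1 l - M.mean (z i).2 l) * ((z i).1 m - M.mean (z i).2 m) with hP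
    -- polarization: `(a + b)² - (a - b)² = 4 a b`
    have hpol : 4 * (P - n * M.cov l m) = ∑ i, ((((z i).1 l - M.mean (z i).2 l) +
        (((1 : ℤˣ) : ℤ) : ℝ) * ((z i).1 m - M.mean (z i).2 m)) ^ 2 -
        (M.cov l l + 2 * (((1 : ℤˣ) : ℤ) : ℝ) * M.cov l m
          + (((1 : ℤˣ) : ℤ) : ℝ) ^ 2 * M.cov m m)) -
        ∑ i, ((((z i).1 l - M.mean (z i).2 l) +
        (((-1 : ℤˣ) : ℤ) : ℝ) * ((z i).1 m - M.mean (z i).2 m)) ^ 2 -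
        (M.cov l l + 2 * (((-1 : ℤˣ) : ℤ) : ℝ) * M.cov l m
          + (((-1 : ℤˣ) : ℤ) : ℝ) ^ 2 * M.cov m m)) := by
      have hc : (n : ℝ) * M.cov l m = ∑ _i : Fin n, M.cov l m := by simp
      rw [hP, hc, ← Finset.sum_sub_distrib, ← Finset.sum_sub_distrib, Finset.mul_sum]
      refine Finset.sum_congr rfl fun i _ => ?_
      push_cast
      ring
    have hSig : (n - K) * (hatSigma z l m - M.cov l m) =
        (P - n * M.cov l m) - T + K * M.cov l m := by
      have hnK : ((n : ℝ) - K) ≠ 0 := by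
        have : (0 : ℝ) < n - K := by linarith
        exact this.ne'
      have h1 : hatSigma z l m = (P - T) / (n - K) := by
        rw [hatSigma, Matrix.of_apply]
        congr 1
        rw [Finset.sum_congr rfl fun k _ => sum_centred_eq M z (hcard0 k).ne' l m,
          Finset.sum_sub_distrib, sum_sum_classIdx z fun i k =>
            ((z i).1 l - M.mean k l) * ((z i).1 m - M.mean k m)]
      rw [h1]
      field_simp
      ring
    have hcov := abs_le.1 (M.abs_cov_le hv l m)
    have hTle' := abs_le.1 hTle
    have hK0 : (0 : ℝ) ≤ K := K.cast_nonneg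
    have hKc1 := mul_le_mul_of_nonneg_left hcov.1 hK0
    have hKc2 := mul_le_mul_of_nonneg_left hcov.2 hK0
    have hbound : |(n - K) * (hatSigma z l m - M.cov l m)| ≤
        n * s / 2 + n * (s / q) ^ 2 + K * v := by
      rw [hSig, abs_le]
      constructor <;> linarith
    have hhalf : (n : ℝ) / 2 ≤ n - K := by linarith
    rw [abs_mul, abs_of_nonneg (by linarith : (0 : ℝ) ≤ n - K)] at hbound
    have h3 := (mul_le_mul_of_nonneg_right hhalf
      (abs_nonneg (hatSigma z l m - M.cov l m))).trans hbound
    refine le_trans ?_ hτ2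
    have h4 : s + 2 * (s / q) ^ 2 + 2 * K * v / n =
        (n * s / 2 + n * (s / q) ^ 2 + K * v) / (n / 2) := by
      field_simp
    rw [h4, le_div_iff₀ (by positivity)]
    linarith
  · have hlog : ∀ x y : ℝ, q ≤ x → q ≤ y → |x - y| ≤ s → Real.log x - Real.log y ≤ s / q := by
      intro x y hx hy hxy
      have hx0 := hq.trans_le hx
      have hy0 := hq.trans_le hy
      rw [← Real.log_div hx0.ne' hy0.ne']
      calc Real.log (x / y) ≤ x / y - 1 := Real.log_le_sub_one_of_pos (div_pos hx0 hy0)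
        _ = (x - y) / y := by field_simp
        _ ≤ s / y := by gcongr; exact (le_abs_self _).trans hxy
        _ ≤ s / q := by gcongr
    have hk : q ≤ M.prior k := by linarith [hprior k]
    have h1 := hlog _ _ (hpiq k) hk (hpi k)
    have h2 := hlog _ _ hk (hpiq k) (by rw [abs_sub_comm]; exact hpi k)
    rw [abs_le]
    constructor <;> linarith
  · simpa using (hatSigma_posSemidef z (by omega)).dotProduct_mulVec_nonneg u

end MSDA

/-! ### The tail bound and its two consequences -/

namespace MSDA

/-- The constant in front of `λ^{1/3}` in the excess risk bound, for `K` classes and an upper bound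
`D` of `Δ`. -/
def riskConst (K : ℕ) (D : ℝ) : ℝ :=
  1 + 2 * K * ((1 + 3 * D) * √(3 * (K * D) + 16 * (K * D) ^ 2) + 3 * (K * D) + 1)

theorem one_le_riskConst (K : ℕ) {D : ℝ} (hD : 0 ≤ D) : 1 ≤ riskConst K D := by
  unfold riskConst
  have : 0 ≤ 2 * K * ((1 + 3 * D) * √(3 * (K * D) + 16 * (K * D) ^ 2) + 3 * (K * D) + 1) := by
    positivity
  linarith

/-- The tail bound for the failure of the method at deviation level `ε ≤ λ`. The factor `p²` counts
the entries of the covariance matrix. -/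
theorem exists_measure_not_errorWithin_le (K : ℕ) [NeZero K] {D v c₁ B : ℝ} (hD0 : 0 ≤ D)
    (hv1 : 1 ≤ v) (hc₁ : 0 < c₁) (hB : 0 < B) :
    ∃ C c : ℝ, 0 < C ∧ 0 < c ∧ ∀ (p n : ℕ) (M : LDAModel K p) (lam ε : ℝ), 0 < p →
      M.Delta ≤ D → (∀ j, M.cov j j ≤ v) → (∀ k, c₁ / K ≤ M.prior k) →
      0 < ε → ε ≤ lam → ε ≤ B →
      (M.sampleLaw n).real {z | ¬ ErrorWithin M z lam (riskConst K D * lam ^ (1 / 3 : ℝ))} ≤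
        C * (p : ℝ) ^ 2 * Real.exp (-(c * n * ε ^ 2)) := by
  have hK : (1 : ℝ) ≤ K := by exact_mod_cast NeZero.one_le
  -- the averages deviate by at most `ρ ε`, the estimated quantities by at most `a ε`
  set a : ℝ := 1 / (2 * (K * (D + 2))) with ha
  set q : ℝ := c₁ / K / 2 with hq
  set ρ : ℝ := min (q / B) (a / 2 / (1 + 2 / q)) with hρ
  have ha0 : 0 < a := by positivity
  have hq0 : 0 < q := by positivity
  have hρ0 : 0 < ρ := by positivity
  have hρB : ρ * B ≤ q := by
    rw [← le_div_iff₀ hB]; exact min_le_left _ _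
  have hρa : ρ * (1 + 2 / q) ≤ a / 2 := by
    rw [← le_div_iff₀ (by positivity)]; exact min_le_right _ _
  have haK : K * (D + 2) * a = 1 / 2 := by
    rw [ha]; field_simp
  have ha1 : a ≤ 1 := by
    rw [ha, div_le_one (by positivity)]; nlinarith
  set c : ℝ := ρ ^ 2 / (4 * (64 * v ^ 2 + 8 * v * q)) with hc
  have hc0 : 0 < c := by positivity
  set N₀ : ℝ := 4 * K * v / a * B + 2 * K * B ^ 2 with hN₀
  have hN0 : 0 < N₀ := by positivity
  refine ⟨4 * K + 4 + Real.exp (c * N₀), c, by positivity, hc0, ?_⟩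
  intro p n M lam ε hp hD hv hprior hε hεlam hεB
  have hp1 : (1 : ℝ) ≤ (p : ℝ) ^ 2 := one_le_pow₀ (by exact_mod_cast hp)
  have hlam0 := hε.trans_le hεlam
  rcases lt_or_ge ((n : ℝ) * ε ^ 2) N₀ with hsmall | hlarge
  · -- the claimed bound exceeds one
    refine measureReal_le_one.trans ?_
    have h1 : Real.exp (-(c * N₀)) ≤ Real.exp (-(c * n * ε ^ 2)) := by
      apply Real.exp_le_exp.2
      rw [mul_assoc]
      exact neg_le_neg (mul_le_mul_of_nonneg_left hsmall.le hc0.le)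
    calc (1 : ℝ) = Real.exp (c * N₀) * 1 * Real.exp (-(c * N₀)) := by
          rw [mul_one, ← Real.exp_add, add_neg_cancel, Real.exp_zero]
      _ ≤ (4 * K + 4 + Real.exp (c * N₀)) * (p : ℝ) ^ 2 * Real.exp (-(c * n * ε ^ 2)) := by
          gcongr
          exact le_add_of_nonneg_left (by positivity)
  · have hnε : 4 * K * v / a ≤ n * ε := by
      have h1 : 4 * K * v / a * B ≤ n * ε * B := by
        calc 4 * K * v / a * B ≤ N₀ := le_add_of_nonneg_right (by positivity)
          _ ≤ n * ε ^ 2 := hlarge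
          _ = n * ε * ε := by ring
          _ ≤ n * ε * B := by gcongr
      exact le_of_mul_le_mul_right h1 hB
    have hnK : 2 * (K : ℝ) ≤ n := by
      have h1 : 2 * (K : ℝ) * B ^ 2 ≤ n * B ^ 2 := by
        calc 2 * (K : ℝ) * B ^ 2 ≤ N₀ := le_add_of_nonneg_left (by positivity)
          _ ≤ n * ε ^ 2 := hlarge
          _ ≤ n * B ^ 2 := by gcongr
      exact le_of_mul_le_mul_right h1 (by positivity)
    have hn0 : (0 : ℝ) < n := by linarith
    have hs0 : 0 ≤ ρ * ε := by positivity
    have hsq : ρ * ε ≤ q := (mul_le_mul_of_nonneg_left hεB hρ0.le).trans hρB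
    have hτ : 2 * (ρ * ε / q) + ρ * ε ≤ a * ε / 2 := by
      have := mul_le_mul_of_nonneg_right hρa hε.le
      calc 2 * (ρ * ε / q) + ρ * ε = ρ * (1 + 2 / q) * ε := by ring
        _ ≤ a / 2 * ε := this
        _ = a * ε / 2 := by ring
    have hquot : 0 ≤ ρ * ε / q := by positivity
    have haε : 0 < a * ε := by positivity
    have hsub : {z : Fin n → EuclideanSpace ℝ (Fin p) × Fin K |
        ¬ ErrorWithin M z lam (riskConst K D * lam ^ (1 / 3 : ℝ))} ⊆
        {z | ∃ t, n * (ρ * ε) ≤ |∑ i, stat M t (z i)|} := by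
      intro z hz
      by_contra hcon
      simp only [Set.mem_ofPred_eq, not_exists, not_le] at hcon
      have hclose : Close M z (a * ε) := by
        refine close_of_stat_lt hs0 hq0 (fun k => ?_) hsq hv (by exact_mod_cast hn0)
          (by exact_mod_cast hnK) ?_ ?_ hcon
        · rw [hq]; linarith [hprior k]
        · linarith
        · have h1 : (ρ * ε / q) ^ 2 ≤ ρ * ε / q := by
            rw [sq]
            exact mul_le_of_le_one_left hquot ((div_le_one hq0).2 hsq)
          have h2 : 2 * K * v / n ≤ a * ε / 2 := by
            rw [div_le_iff₀ ha0] at hnε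
            rw [div_le_iff₀ hn0]
            linarith
          linarith
      refine hz (hclose.errorWithin (fun k => (by positivity : 0 < c₁ / K).trans_le (hprior k)) hD
        ?_ hlam0 ((mul_le_of_le_one_left hε.le ha1).trans hεlam) (one_le_riskConst K hD0)
        (le_add_of_nonneg_left zero_le_one))
      calc K * (D + 2) * (a * ε) = 1 / 2 * ε := by rw [← mul_assoc, haK]
        _ ≤ lam / 2 := by linarith
    calc _ ≤ _ := measureReal_mono hsub
      _ ≤ (4 * K + 4) * (p : ℝ) ^ 2 *
          Real.exp (-(n * (ρ * ε) ^ 2 / (4 * (64 * v ^ 2 + 8 * v * q)))) :=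
        measure_exists_stat_ge_le M hv hv1 hp n hs0 hsq
      _ = (4 * K + 4) * (p : ℝ) ^ 2 * Real.exp (-(c * n * ε ^ 2)) := by
        congr 3; rw [hc]; ring
      _ ≤ _ := by
        refine mul_le_mul_of_nonneg_right (mul_le_mul_of_nonneg_right ?_ (by positivity))
          (Real.exp_pos _).le
        exact le_add_of_nonneg_right (Real.exp_pos _).le

theorem support_nonempty_of_classDist_pos {K p : ℕ} [NeZero K] (hK : 2 ≤ K) (M : LDAModel K p)
    (h : ∀ k l, k ≠ l → 0 < M.classDist k l) : M.support.Nonempty := by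
  by_contra hne
  have hθ : ∀ k, M.theta k = 0 := fun k => by
    ext j
    by_contra hj
    exact hne ⟨j, by simpa [LDAModel.support] using ⟨k, hj⟩⟩
  have hlt := h ⟨0, by omega⟩ ⟨1, by omega⟩ (by simp)
  simp [LDAModel.classDist, hθ] at hlt

theorem log_le_of_rate_le {K p n : ℕ} [NeZero K] (M : LDAModel K p) (hM : M.support.Nonempty)
    (hn : 0 < n) {x : ℝ} (hx : rate M n ≤ x) : Real.log p ≤ n * x ^ 2 := by
  have hp : 0 < p := Fin.pos_iff_nonempty.2 ⟨hM.choose⟩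
  have hp1 : (1 : ℝ) ≤ p := by exact_mod_cast hp
  have hd1 : (1 : ℝ) ≤ M.d := by exact_mod_cast Finset.card_pos.2 hM
  have hn0 : (0 : ℝ) < n := by exact_mod_cast hn
  have h1 : (M.d : ℝ) ^ 2 * Real.log ((p : ℝ) * M.d) / n ≤ x ^ 2 :=
    (Real.sqrt_le_iff.1 hx).2
  have h2 : Real.log p ≤ Real.log ((p : ℝ) * M.d) :=
    Real.log_le_log (by linarith) (le_mul_of_one_le_right (by linarith) hd1)
  have h3 : Real.log ((p : ℝ) * M.d) ≤ (M.d : ℝ) ^ 2 * Real.log ((p : ℝ) * M.d) :=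
    le_mul_of_one_le_left ((Real.log_nonneg hp1).trans h2) (one_le_pow₀ hd1)
  rw [div_le_iff₀ hn0] at h1
  linarith

end MSDA

end

theorem theorem2 (K : ℕ) [NeZero K] (hK : 2 ≤ K)
    (phi₀ Delta₀ eta₀ kappa₀ c₁ C₁ v₀ : ℝ) (hkappa₀ : kappa₀ < 1) (hc₁ : 0 < c₁) :
    -- the finite-sample bound
    (∃ M₁ C c : ℝ, 0 < M₁ ∧ 0 < C ∧ 0 < c ∧
      ∀ (p n : ℕ) (M : LDAModel K p) (lam ε : ℝ),
        M.support.Nonempty →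
        M.phi ≤ phi₀ → M.Delta ≤ Delta₀ → M.etaStar ≤ eta₀ → (∀ j, M.cov j j ≤ v₀) →
        M.kappa ≤ kappa₀ →
        M.Balanced c₁ C₁ →
        0 < lam → lam < min (M.thetaMin / (8 * M.phi)) (M₁ * (1 - M.kappa)) →
        0 < ε → ε < min (1 / (2 * M.phi)) (lam / (1 + M.phi * M.Delta)) →
        (M.sampleLaw n).real {z | ¬ MSDA.ErrorWithin M z lam (M₁ * lam ^ (1 / 3 : ℝ))} <
          C * p * M.d * Real.exp (-(c * n * (ε ^ 2 / (K * (M.d : ℝ) ^ 2))))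
            + C * K * Real.exp (-(c * (n / (K : ℝ) ^ 2)))
            + C * p * ((K : ℝ) - 1) * Real.exp (-(c * n * (ε ^ 2 / K)))) ∧
    -- consistency
    (∀ (n p : ℕ → ℕ) (M : ∀ i, LDAModel K (p i)) (lam : ℕ → ℝ),
        (∀ i, (M i).phi ≤ phi₀) → (∀ i, (M i).Delta ≤ Delta₀) → (∀ i, (M i).etaStar ≤ eta₀) →
        (∀ i j, (M i).cov j j ≤ v₀) →
        (∀ i, (M i).kappa ≤ kappa₀) →
        (∀ i, (M i).Balanced c₁ C₁) →
        Tendsto n atTop atTop → Tendsto p atTop atTop →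
        Tendsto (fun i => ((M i).d : ℝ) ^ 2 * Real.log ((p i : ℝ) * (M i).d) / n i)
          atTop (𝓝 0) →
        (fun i => MSDA.rate (M i) (n i)) =o[atTop] (fun i => (M i).thetaMin) →
        (∃ c₄ : ℝ, 0 < c₄ ∧ ∀ i k l, k ≠ l → c₄ ≤ (M i).classDist k l) →
        (∀ i, 0 < lam i) → Tendsto lam atTop (𝓝 0) →
        (fun i => MSDA.rate (M i) (n i)) =o[atTop] lam →
        ∀ δ : ℝ, 0 < δ →
          Tendsto (fun i => ((M i).sampleLaw (n i)).real
            {z | ¬ MSDA.ErrorWithin (M i) z (lam i) δ}) atTop (𝓝 0)) := by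
  have hK2 : (2 : ℝ) ≤ K := by exact_mod_cast hK
  have hD0 : 0 ≤ max Delta₀ 0 := le_max_right _ _
  have hv1 : 1 ≤ max v₀ 1 := le_max_right _ _
  set M₁ := MSDA.riskConst K (max Delta₀ 0)
  have hM₁1 : 1 ≤ M₁ := MSDA.one_le_riskConst K hD0
  have hM₁0 : 0 < M₁ := by linarith
  constructor
  · obtain ⟨C, c, hC, hc, hbound⟩ :=
      MSDA.exists_measure_not_errorWithin_le K (B := M₁) hD0 hv1 hc₁ hM₁0
    refine ⟨M₁, √C + 1, c / 2, hM₁0, by positivity, by positivity, ?_⟩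
    intro p n M lam ε hM _ hD _ hv _ hbal hlam hlamlt hε hεlt
    have hp : 0 < p := Fin.pos_iff_nonempty.2 ⟨hM.choose⟩
    have hp1 : (1 : ℝ) ≤ p := by exact_mod_cast hp
    have hphi : 0 ≤ M.phi := le_max_of_le_left
      (Real.iSup_nonneg fun _ => Finset.sum_nonneg fun _ _ => abs_nonneg _)
    have hkappa : 0 ≤ M.kappa := Real.iSup_nonneg fun _ => Real.sqrt_nonneg _
    have hεlam : ε ≤ lam := by
      have h1 := (hεlt.trans_le (min_le_right _ _)).le
      exact h1.trans (div_le_self hlam.le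
        (le_add_of_nonneg_right (mul_nonneg hphi M.Delta_nonneg)))
    have hlamM : lam ≤ M₁ :=
      (hlamlt.trans_le (min_le_right _ _)).le.trans (mul_le_of_le_one_right hM₁0.le (by linarith))
    set P := (M.sampleLaw n).real {z | ¬ MSDA.ErrorWithin M z lam (M₁ * lam ^ (1 / 3 : ℝ))}
    have hP0 : 0 ≤ P := measureReal_nonneg
    have hP1 : P ≤ 1 := measureReal_le_one
    have hPle : P ≤ C * (p : ℝ) ^ 2 * Real.exp (-(c * n * ε ^ 2)) :=
      hbound p n M lam ε hp (hD.trans (le_max_left _ _)) (fun j => (hv j).trans (le_max_left _ _))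
        (fun k => (hbal.1 k).1) hε hεlam (hεlam.trans hlamM)
    -- since `P ≤ 1`, also `P ≤ √P`; this halves the exponent and turns the factor `p²` into `p`
    have hPsqrt : P ≤ √C * p * Real.exp (-(c / 2 * n * ε ^ 2)) := by
      have h1 : P ^ 2 ≤ (√C * p * Real.exp (-(c / 2 * n * ε ^ 2))) ^ 2 := by
        rw [mul_pow, mul_pow, Real.sq_sqrt hC.le, ← Real.exp_nat_mul]
        calc P ^ 2 ≤ P := by nlinarith
          _ ≤ _ := hPle
          _ = _ := by congr 2; push_cast; ring
      exact le_of_sq_le_sq h1 (by positivity)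
    have hexp : Real.exp (-(c / 2 * n * ε ^ 2)) ≤ Real.exp (-(c / 2 * n * (ε ^ 2 / K))) := by
      apply Real.exp_le_exp.2
      gcongr
      exact div_le_self (sq_nonneg _) (by linarith)
    calc P ≤ √C * p * Real.exp (-(c / 2 * n * ε ^ 2)) := hPsqrt
      _ ≤ √C * p * 1 * Real.exp (-(c / 2 * n * (ε ^ 2 / K))) := by rw [mul_one]; gcongr
      _ < (√C + 1) * p * ((K : ℝ) - 1) * Real.exp (-(c / 2 * n * (ε ^ 2 / K))) := by
          refine mul_lt_mul_of_pos_right ?_ (Real.exp_pos _)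
          have h1 : 0 ≤ √C := Real.sqrt_nonneg C
          calc √C * p * 1 < (√C + 1) * p * 1 := by nlinarith
            _ ≤ (√C + 1) * p * ((K : ℝ) - 1) := by
              gcongr
              linarith
      _ ≤ _ := le_add_of_nonneg_left (by positivity)
  · intro n p M lam _ hD _ hv _ hbal hn hp _ _ hdist hlam0 hlam hrate δ hδ
    obtain ⟨c₄, hc₄, hdist⟩ := hdist
    obtain ⟨C, c, hC, hc, hbound⟩ :=
      MSDA.exists_measure_not_errorWithin_le K (B := 1) hD0 hv1 hc₁ one_pos
    have hM : ∀ i, (M i).support.Nonempty := fun i =>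
      MSDA.support_nonempty_of_classDist_pos hK (M i) fun k l hkl => hc₄.trans_le (hdist i k l hkl)
    have hpR : Tendsto (fun i => (p i : ℝ)) atTop atTop := tendsto_natCast_atTop_atTop.comp hp
    have hrisk : Tendsto (fun i => M₁ * lam i ^ (1 / 3 : ℝ)) atTop (𝓝 0) := by
      have := (hlam.rpow_const (p := (1 / 3 : ℝ)) (Or.inr (by norm_num))).const_mul M₁
      simpa using this
    refine squeeze_zero' (g := fun i => C * (p i : ℝ)⁻¹)
      (Eventually.of_forall fun i => measureReal_nonneg) ?_
      (by simpa using (tendsto_inv_atTop_zero.comp hpR).const_mul C)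
    -- `log p ≤ c n λ² / 3`, so that the exponential absorbs `p³`
    filter_upwards [hrate.bound (by positivity : 0 < √(c / 3)), hn.eventually_gt_atTop 0,
      hp.eventually_gt_atTop 0, hlam.eventually_le_const one_pos,
      hrisk.eventually_le_const hδ] with i hri hni hpi hlami hriski
    have hp0 : (0 : ℝ) < p i := by exact_mod_cast hpi
    have hlog : 3 * Real.log (p i) ≤ c * n i * lam i ^ 2 := by
      rw [Real.norm_of_nonneg (show 0 ≤ MSDA.rate (M i) (n i) from Real.sqrt_nonneg _),
        Real.norm_of_nonneg (hlam0 i).le] at hri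
      have := MSDA.log_le_of_rate_le (M i) (hM i) hni hri
      rw [mul_pow, Real.sq_sqrt (by positivity)] at this
      linarith
    calc _ ≤ ((M i).sampleLaw (n i)).real
          {z | ¬ MSDA.ErrorWithin (M i) z (lam i) (M₁ * lam i ^ (1 / 3 : ℝ))} :=
          measureReal_mono (Set.compl_subset_compl.2 fun z h => MSDA.ErrorWithin.mono h hriski)
      _ ≤ C * (p i : ℝ) ^ 2 * Real.exp (-(c * n i * lam i ^ 2)) :=
          hbound (p i) (n i) (M i) (lam i) (lam i) hpi ((hD i).trans (le_max_left _ _))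
            (fun j => (hv i j).trans (le_max_left _ _)) (fun k => ((hbal i).1 k).1) (hlam0 i) le_rfl
            hlami
      _ ≤ C * (p i : ℝ) ^ 2 * ((p i : ℝ) ^ 3)⁻¹ := by
          gcongr
          rw [← Real.exp_log (by positivity : 0 < ((p i : ℝ) ^ 3)⁻¹), Real.log_inv, Real.log_pow]
          apply Real.exp_le_exp.2
          push_cast
          linarith
      _ = C * (p i : ℝ)⁻¹ := by field_simp
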